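/- Let $\ell\ge 2$ be a fixed integer. Let $G=(V,E)$ be a finite simple undirected graph with $V=\{0,\dots,n-1\}$ in which every vertex $v$ carries a real-valued attribute $A_v$. For an interval $q=[x_1,x_2]$ with real endpoints, let $G_q$ be the subgraph of $G$ induced by the vertices $v$ with $x_1\le A_v\le x_2$. Let $\#P_\ell$ be the number of $\ell$-paths of $G$, i.e. of subgraphs of $G$ that are paths with $\ell$ edges. In the RAM model with words of $O(\log n)$ bits, in which real numbers are stored in cells of their own and are only copied and compared, there is a query algorithm, depending only on $\ell$, such that for every such $G$ and $A$ there is a data structure occupying $\tilde O(\#P_\ell)$ memory cells from which, given any $q=[x_1,x_2]$, the algorithm lists all the $2\ell$-cycles of $G_q$ (the subgraphs of $G_q$ that are cycles with $2\ell$ vertices), each exactly once, with a delay of $\tilde O(1)$: the first cycle is reported, or the absence of cycles declared, within $\tilde O(1)$ time from the start of the query, and after each reported cycle the next cycle is reported, or the end of the list declared, within $\tilde O(1)$ time. Time is the number of atomic operations; $\tilde O(\cdot)$ hides a constant factor and a factor polylogarithmic in $n$, both depending only on $\ell$. -/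

import Mathlib

/-! ### Range subgraph listing -/

/-- The occurrences of a pattern graph `Q` in `G`: the (not necessarily induced) subgraphs of `G`
that are isomorphic to `Q`. -/
def occurrences {k : ℕ} {V : Type*} (Q : SimpleGraph (Fin k)) (G : SimpleGraph V) :
    Set G.Subgraph :=
  {H | Nonempty (Q ≃g H.coe)}

/-- `G_q` for `q = [x₁, x₂]`: the subgraph of `G` induced by the vertices whose attribute lies
in `[x₁, x₂]`. -/
def rangeSubgraph {V : Type*} (G : SimpleGraph V) (A : V → ℝ) (x₁ x₂ : ℝ) : G.Subgraph :=
  (⊤ : G.Subgraph).induce {v | x₁ ≤ A v ∧ A v ≤ x₂}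

/-- The occurrences of `Q` in `G_q`, `q = [x₁, x₂]`. -/
def rangeOccurrences {k : ℕ} {V : Type*} (Q : SimpleGraph (Fin k)) (G : SimpleGraph V)
    (A : V → ℝ) (x₁ x₂ : ℝ) : Set G.Subgraph :=
  {H ∈ occurrences Q G | H ≤ rangeSubgraph G A x₁ x₂}

/-- `#P_ℓ`: the number of `ℓ`-paths (paths with `ℓ` edges) in `G`, as subgraphs. -/
noncomputable def numPaths {V : Type*} (ℓ : ℕ) (G : SimpleGraph V) : ℕ :=
  (occurrences (SimpleGraph.pathGraph (ℓ + 1)) G).ncard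

/-! ### The machine

A RAM whose words are natural numbers below `2 ^ b`. It has a read-only data structure (an array
of words and an array of real numbers), a read/write working memory of words, all `0` at the
start, a bank of real registers, and an append-only output tape of words. Real numbers can only
be fetched from the structure and compared with each other. -/

/-- The binary operations on words. Comparisons return `1` (true) or `0` (false). -/
inductive WordOp where
  | add
  | sub
  | mul
  | div
  | mod
  | lt
  | eq

/-- The value of a binary operation on `b`-bit words: addition and multiplication are modulo
`2 ^ b`, subtraction is truncated at `0`. -/
def WordOp.value (b : ℕ) : WordOp → ℕ → ℕ → ℕ
  | .add, x, y => (x + y) % 2 ^ b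
  | .sub, x, y => x - y
  | .mul, x, y => (x * y) % 2 ^ b
  | .div, x, y => x / y
  | .mod, x, y => x % y
  | .lt, x, y => if x < y then 1 else 0
  | .eq, x, y => if x = y then 1 else 0

/-- Programs. Here `d x y a s` are (constant) addresses of cells of the working memory `M` and
`r r'` are indices of real registers `R`. -/
inductive Program where
  /-- `M[d] := k` -/
  | const (d k : ℕ)
  /-- `M[d] := o (M[x], M[y])` -/
  | op (o : WordOp) (d x y : ℕ)
  /-- `M[d] := M[M[a]]` -/
  | load (d a : ℕ)
  /-- `M[M[a]] := M[s]` -/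
  | store (a s : ℕ)
  /-- `M[d] :=` word number `M[a]` of the data structure -/
  | fetch (d a : ℕ)
  /-- `R[r] :=` real number `M[a]` of the data structure -/
  | fetchReal (r a : ℕ)
  /-- `M[d] := 1` if `R[r] ≤ R[r']`, and `M[d] := 0` otherwise -/
  | leReal (d r r' : ℕ)
  /-- append `M[a]` to the output -/
  | emit (a : ℕ)
  /-- do nothing -/
  | skip
  /-- `p; p'` -/
  | seq (p p' : Program)
  /-- if `M[x] ≠ 0` then `p` else `p'` -/
  | ite (x : ℕ) (p p' : Program)
  /-- while `M[x] ≠ 0` do `p` -/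
  | loop (x : ℕ) (p : Program)

/-- A data structure, as it is laid out in the read-only memory. -/
structure DataStructure where
  words : List ℕ
  reals : List ℝ

/-- The space of a data structure: its number of memory cells. -/
def DataStructure.space (S : DataStructure) : ℕ := S.words.length + S.reals.length

/-- The configuration of a running machine; `todo` is the stack of the program parts that remain
to be executed. -/
structure Config where
  todo : List Program
  mem : ℕ → ℕ
  reg : ℕ → ℝ
  out : List ℕ

/-- The machine has halted. -/
def Config.Halted (c : Config) : Prop := c.todo = []

open Classical in
/-- One step, i.e. one atomic operation, of the machine with word length `b` and data
structure `S`. Reading outside the arrays of `S` returns `0`. -/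
noncomputable def Config.step (b : ℕ) (S : DataStructure) (c : Config) : Config :=
  match c.todo with
  | [] => c
  | .const d k :: ps => { c with todo := ps, mem := Function.update c.mem d (k % 2 ^ b) }
  | .op o d x y :: ps =>
      { c with todo := ps, mem := Function.update c.mem d (o.value b (c.mem x) (c.mem y)) }
  | .load d a :: ps => { c with todo := ps, mem := Function.update c.mem d (c.mem (c.mem a)) }
  | .store a s :: ps => { c with todo := ps, mem := Function.update c.mem (c.mem a) (c.mem s) }
  | .fetch d a :: ps =>
      { c with todo := ps, mem := Function.update c.mem d (S.words.getD (c.mem a) 0) }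
  | .fetchReal r a :: ps =>
      { c with todo := ps, reg := Function.update c.reg r (S.reals.getD (c.mem a) 0) }
  | .leReal d r r' :: ps =>
      { c with
        todo := ps
        mem := Function.update c.mem d (if c.reg r ≤ c.reg r' then 1 else 0) }
  | .emit a :: ps => { c with todo := ps, out := c.out ++ [c.mem a] }
  | .skip :: ps => { c with todo := ps }
  | .seq p p' :: ps => { c with todo := p :: p' :: ps }
  | .ite x p p' :: ps => { c with todo := (if c.mem x = 0 then p' else p) :: ps }
  | .loop x p :: ps => { c with todo := if c.mem x = 0 then ps else p :: .loop x p :: ps }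

/-- The initial configuration of a query `[x₁, x₂]`: the endpoints are in the real registers
`0` and `1`, and everything else is blank. -/
def Config.init (P : Program) (x₁ x₂ : ℝ) : Config where
  todo := [P]
  mem := fun _ => 0
  reg := fun r => if r = 0 then x₁ else if r = 1 then x₂ else 0
  out := []

/-- The configuration after `t` steps of the query algorithm `P` on the structure `S` and the
query `[x₁, x₂]`. -/
noncomputable def queryRun (b : ℕ) (S : DataStructure) (P : Program) (x₁ x₂ : ℝ) (t : ℕ) :
    Config :=
  (Config.step b S)^[t] (Config.init P x₁ x₂)

/-! ### Listing with a delay -/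

/-- The list of words `w` describes the occurrence `H` of `Q`: it lists the vertices of `H` that
correspond to the vertices `0, 1, …, k - 1` of `Q` under some isomorphism. For a cycle this is
the list of its vertices in cyclic order. -/
def Describes {k n : ℕ} (Q : SimpleGraph (Fin k)) {G : SimpleGraph (Fin n)} (H : G.Subgraph)
    (w : List ℕ) : Prop :=
  ∃ f : Q ≃g H.coe, w = List.ofFn fun i => ((f i : Fin n) : ℕ)

/-- The run lists every element of `occ` exactly once (in some order, each described by `k`
output words) and then halts, with a delay of at most `Δ`: from any moment on, within `Δ` steps
the output of a further occurrence is completed or the machine has halted. -/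
structure ListsWithDelay {k n : ℕ} (Q : SimpleGraph (Fin k)) {G : SimpleGraph (Fin n)}
    (occ : Set G.Subgraph) (run : ℕ → Config) (Δ : ℕ) : Prop where
  lists : ∃ (T : ℕ) (Hs : List G.Subgraph) (ws : List (List ℕ)),
    (run T).Halted ∧ (run T).out = ws.flatten ∧ List.Forall₂ (Describes Q) Hs ws ∧
      Hs.Nodup ∧ ∀ H, H ∈ Hs ↔ H ∈ occ
  delay : ∀ t, (run (t + Δ)).Halted ∨ (run t).out.length / k < (run (t + Δ)).out.length / k

/-- The number of bits of `n` (with value `1` at `n = 0`): the logarithm in `Õ` and in the word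
length. -/
def logSize (n : ℕ) : ℕ := Nat.log 2 n + 1

/-! Put r = ℓ - 1. The least vertex of a 2ℓ-cycle and the vertex opposite to it cut the cycle into
two ℓ-paths that start at the least vertex and share only their ends; the cycle determines this
unordered pair of rooted paths, and every such pair closes up to a cycle (`exists_cycleOf_eq`,
`cycleOf_inj`). The number N of rooted paths is at most a constant times #P_ℓ
(`card_rootedPaths_le`), so it suffices to list disjoint pairs of rooted paths with equal ends from
a table of size Õ(N).

Sort the rooted paths by their ends, and by decreasing smallest attribute among equal ends. A pair
is recorded as (p, i) with i before p in the same group. The smallest attribute of i is then at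
least that of p, so x₁ is a condition on p alone, while x₂ bounds the largest attributes of both.

Inner search: given p, find the next i of its group that avoids the inner vertices of p and has
largest attribute at most x₂. Each block of 2^m consecutive paths stores boundedly many weighted
representatives: if some path of the block avoids a set of at most r vertices, a stored one does so
too, with no larger top attribute (`exists_representatives`). Whether a block contains a hit is thus
decided in constant time, and binary lifting over the levels m finds the next hit in O(log n) steps
(`eval_findNext`).

Outer search: no time may be lost on a p without partner in range. The need of p is the maximum of
its own top attribute and the least top attribute among its partners. The paths with partners are
ordered by decreasing smallest attribute, so x₁ selects a prefix, and block minima of the needs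
allow the same lifting to jump to the next p whose need is at most x₂. Every p loaded this way
contributes a cycle, so at most two rounds of O(log n) steps separate consecutive reports
(`RoundInv.eval_round`, `query_spec`). -/

/-! ### Execution of programs -/

/-- The part of a configuration that is visible to a running program. -/
structure Store where
  mem : ℕ → ℕ
  reg : ℕ → ℝ
  out : List ℕ

/-- The configuration with store `s` and remaining program parts `ps`. -/
def Store.config (s : Store) (ps : List Program) : Config := ⟨ps, s.mem, s.reg, s.out⟩

/-- The store `s` with cell `d` set to `v`. -/
def Store.set (s : Store) (d v : ℕ) : Store := { s with mem := Function.update s.mem d v }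

/-- The store `s` with register `d` set to `x`. -/
noncomputable def Store.setReg (s : Store) (d : ℕ) (x : ℝ) : Store :=
  { s with reg := Function.update s.reg d x }

/-- Word number `a` of the structure, as the machine reads it. -/
def DataStructure.word (S : DataStructure) (a : ℕ) : ℕ := S.words.getD a 0

/-- Real number `a` of the structure, as the machine reads it. -/
noncomputable def DataStructure.real (S : DataStructure) (a : ℕ) : ℝ := S.reals.getD a 0

/-- Programs without loops. -/
def Program.LoopFree : Program → Prop
  | .seq p p' => p.LoopFree ∧ p'.LoopFree
  | .ite _ p p' => p.LoopFree ∧ p'.LoopFree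
  | .loop _ _ => False
  | _ => True

/-- A bound for the running time of a loop-free program. -/
def Program.cost : Program → ℕ
  | .seq p p' => p.cost + p'.cost + 1
  | .ite _ p p' => max p.cost p'.cost + 1
  | _ => 1

open Classical in
/-- The effect of a loop-free program. -/
noncomputable def Program.den (b : ℕ) (S : DataStructure) : Program → Store → Store
  | .const d k, s => s.set d (k % 2 ^ b)
  | .op o d x y, s => s.set d (o.value b (s.mem x) (s.mem y))
  | .load d a, s => s.set d (s.mem (s.mem a))
  | .store a x, s => s.set (s.mem a) (s.mem x)
  | .fetch d a, s => s.set d (S.word (s.mem a))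
  | .fetchReal r a, s => s.setReg r (S.real (s.mem a))
  | .leReal d r r', s => s.set d (if s.reg r ≤ s.reg r' then 1 else 0)
  | .emit a, s => { s with out := s.out ++ [s.mem a] }
  | .skip, s => s
  | .seq p p', s => p'.den b S (p.den b S s)
  | .ite x p p', s => if s.mem x = 0 then p'.den b S s else p.den b S s
  | .loop _ _, s => s

/-- The program `p` takes the store `s` to `s'` in at most `T` steps. -/
def Eval (b : ℕ) (S : DataStructure) (p : Program) (T : ℕ) (s s' : Store) : Prop :=
  ∃ t ≤ T, ∀ ps, (Config.step b S)^[t] (s.config (p :: ps)) = s'.config ps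

section
variable {b : ℕ} {S : DataStructure} {p p' : Program} {s s' s'' : Store} {T T' x : ℕ}

theorem Eval.mono (h : Eval b S p T s s') (hT : T ≤ T') : Eval b S p T' s s' := by
  obtain ⟨t, ht, h⟩ := h
  exact ⟨t, ht.trans hT, h⟩

theorem Eval.of_step (h : ∀ ps, Config.step b S (s.config (p :: ps)) = s'.config ps) :
    Eval b S p 1 s s' := ⟨1, le_rfl, h⟩

theorem Eval.seq (h : Eval b S p T s s') (h' : Eval b S p' T' s' s'') :
    Eval b S (.seq p p') (T + T' + 1) s s'' := by
  obtain ⟨t, ht, h⟩ := h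
  obtain ⟨t', ht', h'⟩ := h'
  refine ⟨t' + t + 1, by omega, fun ps => ?_⟩
  rw [Function.iterate_succ_apply, Function.iterate_add_apply]
  have : Config.step b S (s.config (.seq p p' :: ps)) = s.config (p :: p' :: ps) := rfl
  rw [this, h, h']

theorem Eval.ite_neg (hx : s.mem x = 0) (h : Eval b S p' T s s') :
    Eval b S (.ite x p p') (T + 1) s s' := by
  obtain ⟨t, ht, h⟩ := h
  refine ⟨t + 1, by omega, fun ps => ?_⟩
  rw [Function.iterate_succ_apply]
  have : Config.step b S (s.config (.ite x p p' :: ps)) = s.config (p' :: ps) := by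
    simp [Config.step, Store.config, hx]
  rw [this, h]

theorem Eval.ite_pos (hx : s.mem x ≠ 0) (h : Eval b S p T s s') :
    Eval b S (.ite x p p') (T + 1) s s' := by
  obtain ⟨t, ht, h⟩ := h
  refine ⟨t + 1, by omega, fun ps => ?_⟩
  rw [Function.iterate_succ_apply]
  have : Config.step b S (s.config (.ite x p p' :: ps)) = s.config (p :: ps) := by
    simp [Config.step, Store.config, hx]
  rw [this, h]

theorem Eval.loop_stop (hx : s.mem x = 0) : Eval b S (.loop x p) 1 s s :=
  .of_step fun ps => by simp [Config.step, Store.config, hx]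

theorem Eval.loop_continue (hx : s.mem x ≠ 0) (h : Eval b S p T s s')
    (h' : Eval b S (.loop x p) T' s' s'') : Eval b S (.loop x p) (T + T' + 1) s s'' := by
  obtain ⟨t, ht, h⟩ := h
  obtain ⟨t', ht', h'⟩ := h'
  refine ⟨t' + t + 1, by omega, fun ps => ?_⟩
  rw [Function.iterate_succ_apply, Function.iterate_add_apply]
  have : Config.step b S (s.config (.loop x p :: ps)) = s.config (p :: .loop x p :: ps) := by
    simp [Config.step, Store.config, hx]
  rw [this, h, h']

/-- Repetitions whose number depends only on ℓ are unrolled in the query program, so their cost is a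
constant. Genuine loops remain only in `findNext` and around the rounds. -/
theorem Program.LoopFree.eval (hp : p.LoopFree) (s : Store) :
    Eval b S p p.cost s (p.den b S s) := by
  induction p generalizing s with
  | seq p p' ih ih' => exact (ih hp.1 s).seq (ih' hp.2 _)
  | ite x p p' ih ih' =>
    by_cases hx : s.mem x = 0
    · have := (ih' hp.2 s).ite_neg (p := p) hx
      simp only [den, hx, if_true]
      exact this.mono (by simp [cost])
    · have := (ih hp.1 s).ite_pos (p' := p') hx
      simp only [den, hx, if_false]
      exact this.mono (by simp [cost])
  | loop => exact hp.elim
  | _ => exact .of_step fun ps => rfl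

/-- A loop whose body is loop-free, run while an invariant counts down. -/
theorem Eval.loop_of_invariant (hp : p.LoopFree) (I : ℕ → Store → Prop)
    (hI : ∀ m s, I (m + 1) s → s.mem x ≠ 0 ∧ I m (p.den b S s)) (h0 : ∀ s, I 0 s → s.mem x = 0)
    (m : ℕ) (hs : I m s) : ∃ s', I 0 s' ∧ Eval b S (.loop x p) (m * (p.cost + 1) + 1) s s' := by
  induction m generalizing s with
  | zero => exact ⟨s, hs, by simpa using Eval.loop_stop (h0 s hs)⟩
  | succ m ih =>
    obtain ⟨hx, h⟩ := hI m s hs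
    obtain ⟨s', h1, h2⟩ := ih h
    exact ⟨s', h1, (Eval.loop_continue hx (hp.eval s) h2).mono (by ring_nf; omega)⟩

end

/-- The `m`-fold repetition of a program. -/
def Program.repeat (p : Program) : ℕ → Program
  | 0 => .skip
  | m + 1 => .seq (p.repeat m) p

theorem Program.LoopFree.repeat {p : Program} (hp : p.LoopFree) (m : ℕ) :
    (p.repeat m).LoopFree := by
  induction m with
  | zero => trivial
  | succ m ih => exact ⟨ih, hp⟩

theorem Program.den_repeat_invariant {b : ℕ} {S : DataStructure} {p : Program} (I : ℕ → Store → Prop)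
    {m : ℕ} {s : Store} (h0 : I 0 s) (h : ∀ t < m, ∀ s, I t s → I (t + 1) (p.den b S s)) :
    I m ((p.repeat m).den b S s) := by
  induction m with
  | zero => exact h0
  | succ m ih => exact h m (by omega) _ (ih fun t ht => h t (by omega))

/-- Consecutive execution of a list of programs. -/
def Program.block : List Program → Program
  | [] => .skip
  | [p] => p
  | p :: ps => .seq p (Program.block ps)

/-! ### Delay -/

section
variable {b : ℕ} {S : DataStructure}

theorem Config.Halted.iterate {c : Config} (h : c.Halted) (t : ℕ) :
    (Config.step b S)^[t] c = c := by
  refine Function.iterate_fixed ?_ t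
  unfold Config.Halted at h
  simp [Config.step, h]

theorem Config.Halted.of_le {c : Config} {t t' : ℕ} (h : ((Config.step b S)^[t] c).Halted)
    (ht : t ≤ t') : ((Config.step b S)^[t'] c).Halted := by
  obtain ⟨u, rfl⟩ := Nat.exists_eq_add_of_le' ht
  rwa [Function.iterate_add_apply, h.iterate]

theorem Config.length_out_step (c : Config) : c.out.length ≤ (c.step b S).out.length := by
  unfold Config.step
  split <;> simp

theorem Config.length_out_iterate (c : Config) {t t' : ℕ} (ht : t ≤ t') :
    ((Config.step b S)^[t] c).out.length ≤ ((Config.step b S)^[t'] c).out.length := by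
  induction t', ht using Nat.le_induction with
  | base => rfl
  | succ m _ ih =>
    rw [Function.iterate_succ_apply']
    exact ih.trans (length_out_step _)

/-- If every block of `k` words is output within `D` steps of the previous one, and the machine
halts within `D` steps of the last one, then the delay is at most `2 * D`. -/
theorem delay_of_blocks {k D : ℕ} (hk : 0 < k) (I : List (List ℕ) → Config → Prop)
    (hI : ∀ w ws c, I (w :: ws) c → w.length = k ∧ ∃ t ≤ D, I ws ((Config.step b S)^[t] c) ∧
      ((Config.step b S)^[t] c).out = c.out ++ w)
    (h0 : ∀ c, I [] c → ∃ t ≤ D, ((Config.step b S)^[t] c).Halted ∧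
      ((Config.step b S)^[t] c).out = c.out)
    (ws : List (List ℕ)) (c : Config) (hc : I ws c) (i : ℕ) (hi : c.out.length = k * i) :
    (∃ T, ((Config.step b S)^[T] c).Halted ∧ ((Config.step b S)^[T] c).out = c.out ++ ws.flatten) ∧
      ∀ t, ((Config.step b S)^[t + 2 * D] c).Halted ∨
        ((Config.step b S)^[t] c).out.length / k <
          ((Config.step b S)^[t + 2 * D] c).out.length / k := by
  induction ws generalizing c i with
  | nil =>
    obtain ⟨t, ht, h1, h2⟩ := h0 c hc
    exact ⟨⟨t, h1, by simpa using h2⟩, fun u => .inl (h1.of_le (by omega))⟩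
  | cons w ws ih =>
    obtain ⟨hw, t₁, ht₁, h1, h2⟩ := hI w ws c hc
    have hl : ((Config.step b S)^[t₁] c).out.length = k * (i + 1) := by
      rw [h2, List.length_append, hi, hw]; ring
    obtain ⟨⟨T, hT, hT'⟩, hd⟩ := ih _ h1 (i + 1) hl
    refine ⟨⟨T + t₁, by rwa [Function.iterate_add_apply], ?_⟩, fun t => ?_⟩
    · rw [Function.iterate_add_apply, hT', h2]; simp
    by_cases ht : t₁ ≤ t
    · obtain ⟨u, rfl⟩ := Nat.exists_eq_add_of_le' ht
      have := hd u
      rw [← Function.iterate_add_apply, ← Function.iterate_add_apply] at this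
      rwa [show u + t₁ + 2 * D = u + 2 * D + t₁ by ring]
    -- At a time before `t₁` the first block may already be complete, so its end need not be a gain.
    -- Only the second block is certainly new; this is the reason for the factor 2.
    · cases ws with
      | nil =>
        obtain ⟨u, hu, h3, -⟩ := h0 _ h1
        rw [← Function.iterate_add_apply] at h3
        exact .inl (h3.of_le (by omega))
      | cons w' ws =>
        obtain ⟨hw', u, hu, -, h4⟩ := hI w' ws _ h1
        have h5 := congrArg List.length h4
        rw [List.length_append, hl, hw', ← Function.iterate_add_apply] at h5
        have h6 := Config.length_out_iterate (b := b) (S := S) c (t := u + t₁) (t' := t + 2 * D) (by omega)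
        have h7 := Config.length_out_iterate (b := b) (S := S) c (t := t) (t' := t₁) (by omega)
        right
        calc _ ≤ k * (i + 1) / k := Nat.div_le_div_right (hl ▸ h7)
          _ = i + 1 := Nat.mul_div_cancel_left _ hk
          _ < i + 2 := by omega
          _ = (k * (i + 1) + k) / k := by
            rw [show k * (i + 1) + k = k * (i + 2) by ring, Nat.mul_div_cancel_left _ hk]
          _ ≤ _ := Nat.div_le_div_right (h5 ▸ h6)

end

/-! ### The query program -/

/-- `M[d] := M[x] * k + o`, with cell `50` as a scratch cell -/
def Program.affine (d x k o : ℕ) : Program :=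
  .block [.const 50 k, .op .mul d x 50, .const 50 o, .op .add d d 50]

/-- Moves `M[d]` to the next position before `M[e]` at which the search condition holds, by binary
lifting. The subprogram `chk` has to decide into cell `13` whether the condition holds somewhere in
a block of positions of length `M[10] = 2 ^ m` that starts at `M[d]`; cell `11` is the offset
`m * N` of level `m` in the table of blocks. -/
def Program.liftStep (chk : Program) (d e : ℕ) : Program :=
  .block [.op .add 12 d 10, .op .lt 13 e 12,
    .ite 13 .skip (.seq chk (.ite 13 .skip (.affine d 12 1 0))),
    .const 50 2, .op .div 10 10 50, .op .sub 11 11 0]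

/-- Moves `M[d]` to the next position before `M[e]` at which the search condition holds, if any,
and to `M[e]` otherwise, by one `liftStep` for each level, from the top level down. -/
def Program.findNext (chk : Program) (d e : ℕ) : Program :=
  .seq (.block [.affine 10 2 1 0, .affine 11 3 1 0]) (.loop 10 (.liftStep chk d e))

/-- Is the least requirement in the current block of outer positions met? -/
def Program.outerCheck (K : ℕ) : Program :=
  .block [.op .add 20 11 4, .affine 21 20 (3 * K) 1, .fetchReal 2 21, .leReal 13 2 1]

/-- Record into cell `25` whether the word `M[26]` is the word number `M[27]`. -/
def Program.compareWord : Program :=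
  .block [.fetch 28 27, .op .eq 28 28 26, .ite 28 (.const 25 1) .skip, .affine 27 27 1 1]

/-- Record into cell `25` whether word number `M[24]` is among the `r` words from `M[22]` on. -/
def Program.searchWord (r : ℕ) : Program :=
  .block [.fetch 26 24, .affine 27 22 1 0, compareWord.repeat r, .affine 24 24 1 1]

/-- Record into cell `13` whether the path stored in record `M[20]` is in range and avoids the inner
vertices of the current path. -/
def Program.checkRecord (r : ℕ) : Program :=
  .block [.affine 21 20 3 2, .fetchReal 2 21, .leReal 23 2 1, .affine 24 20 (r + 8) 7,
    .const 25 0, (searchWord r).repeat r, .ite 25 .skip (.ite 23 (.const 13 1) .skip),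
    .affine 20 20 1 1]

/-- Is there a partner of the current path in the current block of inner positions? -/
def Program.innerCheck (K r : ℕ) : Program :=
  .block [.affine 22 6 (K * (r + 8)) 7, .op .add 20 11 5, .affine 20 20 K 0, .const 13 0,
    (checkRecord r).repeat K]

/-- Output word number `M[20]`. -/
def Program.emitWord : Program := .seq (.fetch 21 20) (.emit 21)

/-- Output the cycle formed by the paths number `M[6]` and `M[5]`. -/
def Program.emitCycle (K r : ℕ) : Program :=
  .block [.affine 20 6 (K * (r + 8)) 6, (Program.block [emitWord, .affine 20 20 1 1]).repeat (r + 2),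
    .affine 20 5 (K * (r + 8)) (6 + r),
    (Program.block [emitWord, .const 50 1, .op .sub 20 20 50]).repeat r, .affine 5 5 1 1]

/-- Load the next outer path. -/
def Program.loadPath (K r : ℕ) : Program :=
  .block [.affine 20 4 (K * (r + 8)) 4, .fetch 5 20, .affine 20 4 (K * (r + 8)) 5, .fetch 6 20,
    .affine 4 4 1 1]

/-- Load the next outer path if it is in range, else stop. -/
def Program.tryLoad (K r : ℕ) : Program :=
  .seq (.block [.affine 20 4 (3 * K) 0, .fetchReal 2 20, .leReal 15 0 2])
    (.ite 15 (loadPath K r) (.const 7 0))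

/-- One round of the query: report the next cycle with the current path, or else go on to the next
path. -/
def Program.round (K r : ℕ) : Program :=
  .seq (.seq (findNext (innerCheck K r) 5 6) (.op .lt 14 5 6))
    (.ite 14 (emitCycle K r)
      (.seq (findNext (outerCheck K) 4 1) (.seq (.op .lt 14 4 1)
        (.ite 14 (tryLoad K r) (.const 7 0)))))

/-- Load the parameters of the structure. -/
def Program.setup : Program :=
  .block [.const 20 0, .fetch 0 20, .const 20 1, .fetch 1 20, .const 20 2, .fetch 2 20,
    .const 20 3, .fetch 3 20, .const 7 1]

/-- The query algorithm. -/
def Program.query (K r : ℕ) : Program := .seq setup (.loop 7 (round K r))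

/-! ### The structure -/

/-- The contents of the data structure: paths number `0, …, N - 1`, each with vertices
`vert i 0, …, vert i (r + 1)` and largest attribute `top i`; for every block of paths
`rep m j 0, …, rep m j (K - 1)`; and outer positions `0, …, Nout - 1`, where outer position `j`
stands for the path `pos j` with smallest attribute `low j` and candidate partners from `start j`
on; `need m j` is the least upper query endpoint for which some position of the block has a cycle. -/
structure Layout where
  N : ℕ
  Nout : ℕ
  vert : ℕ → ℕ → ℕ
  top : ℕ → ℝ
  rep : ℕ → ℕ → ℕ → ℕ
  start : ℕ → ℕ
  pos : ℕ → ℕ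
  low : ℕ → ℝ
  need : ℕ → ℕ → ℝ

namespace Layout

/-- The inner vertices of path `i`. -/
def interior (D : Layout) (r i : ℕ) : Finset ℕ := (Finset.range r).image fun t => D.vert i (t + 1)

/-- The number of levels of the table of blocks. -/
def levels (D : Layout) : ℕ := Nat.size D.N

/-- `rep_spec` and `need_spec` make a constant-time test of a block equivalent to a search through
it. `low_anti` allows the query to stop at the first path below x₁. `productive` guarantees that a
loaded path yields a cycle, which is what bounds the delay. -/
structure Valid (D : Layout) (K r : ℕ) : Prop where
  Nout_le : D.Nout ≤ D.N
  K_pos : 0 < K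
  rep_mem : ∀ m j s, j + 2 ^ m ≤ D.N → s < K → j ≤ D.rep m j s ∧ D.rep m j s < j + 2 ^ m
  rep_spec : ∀ m j (B : Finset ℕ) i, j + 2 ^ m ≤ D.N → B.card ≤ r → j ≤ i → i < j + 2 ^ m →
    Disjoint (D.interior r i) B → ∃ s < K, Disjoint (D.interior r (D.rep m j s)) B ∧
      D.top (D.rep m j s) ≤ D.top i
  need_spec : ∀ m j x, j + 2 ^ m ≤ D.Nout →
    (D.need m j ≤ x ↔ ∃ i, j ≤ i ∧ i < j + 2 ^ m ∧ D.need 0 i ≤ x)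
  start_le : ∀ j < D.Nout, D.start j ≤ D.pos j
  pos_lt : ∀ j < D.Nout, D.pos j < D.N
  low_anti : ∀ i j, i ≤ j → j < D.Nout → D.low j ≤ D.low i
  productive : ∀ j < D.Nout, ∃ i, D.start j ≤ i ∧ i < D.pos j ∧
    Disjoint (D.interior r i) (D.interior r (D.pos j)) ∧ D.top i ≤ D.need 0 j

/-- Record (m * N + j) * K + s belongs to slot s of the block of length 2^m at j. It has r + 8 words
(four global parameters, two words for position j, r + 2 vertices) and three reals. Data of position
j alone are read from record (0, j, 0). The two bounds keep address arithmetic free of overflow. -/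
structure Stored (D : Layout) (K r b : ℕ) (S : DataStructure) : Prop where
  bound : D.levels * D.N * K * (r + 8) < 2 ^ b
  bound' : 2 * D.N + 8 < 2 ^ b
  word_zero : S.word 0 = D.N
  word_one : S.word 1 = D.Nout
  word_two : S.word 2 = 2 ^ D.levels / 2
  word_three : S.word 3 = (D.levels - 1) * D.N
  word_start : ∀ j < D.N, S.word (j * (K * (r + 8)) + 4) = D.start j
  word_pos : ∀ j < D.N, S.word (j * (K * (r + 8)) + 5) = D.pos j
  word_vert : ∀ m j s t, m < D.levels → j < D.N → s < K → t < r + 2 →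
    S.word (((m * D.N + j) * K + s) * (r + 8) + (6 + t)) = D.vert (D.rep m j s) t
  real_low : ∀ j < D.N, S.real (j * (3 * K)) = D.low j
  real_need : ∀ m j, m < D.levels → j < D.N →
    S.real ((m * D.N + j) * (3 * K) + 1) = D.need m j
  real_top : ∀ m j s, m < D.levels → j < D.N → s < K →
    S.real (((m * D.N + j) * K + s) * 3 + 2) = D.top (D.rep m j s)

end Layout

/-! ### Correctness of the subprograms -/

theorem Store.mem_set (s : Store) (d v a : ℕ) :
    (s.set d v).mem a = if a = d then v else s.mem a := by
  simp [Store.set, Function.update_apply]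

theorem Store.reg_setReg (s : Store) (d : ℕ) (x : ℝ) (a : ℕ) :
    (s.setReg d x).reg a = if a = d then x else s.reg a := by
  simp [Store.setReg, Function.update_apply]

@[simp] theorem Store.mem_setReg (s : Store) (d : ℕ) (x : ℝ) : (s.setReg d x).mem = s.mem := rfl
@[simp] theorem Store.out_setReg (s : Store) (d : ℕ) (x : ℝ) : (s.setReg d x).out = s.out := rfl
@[simp] theorem Store.reg_set (s : Store) (d v : ℕ) : (s.set d v).reg = s.reg := rfl
@[simp] theorem Store.out_set (s : Store) (d v : ℕ) : (s.set d v).out = s.out := rfl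

/-- `s'` agrees with `s` up to scratch cells (those from `c` on) and scratch registers. -/
structure Store.Agree (c : ℕ) (s s' : Store) : Prop where
  mem : ∀ a < c, s'.mem a = s.mem a
  reg_zero : s'.reg 0 = s.reg 0
  reg_one : s'.reg 1 = s.reg 1
  out : s'.out = s.out

section
variable {b : ℕ} {S : DataStructure} {s s' s'' : Store} {c c' : ℕ}

theorem Store.Agree.refl (c : ℕ) (s : Store) : s.Agree c s := ⟨fun _ _ => rfl, rfl, rfl, rfl⟩

theorem Store.Agree.trans (h : s.Agree c s') (h' : s'.Agree c s'') : s.Agree c s'' :=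
  ⟨fun a ha => (h'.mem a ha).trans (h.mem a ha), h'.reg_zero.trans h.reg_zero,
    h'.reg_one.trans h.reg_one, h'.out.trans h.out⟩

theorem Store.Agree.of_le (h : s.Agree c s') (hc : c' ≤ c) : s.Agree c' s' :=
  ⟨fun a ha => h.mem a (ha.trans_le hc), h.reg_zero, h.reg_one, h.out⟩

theorem Store.Agree.set (h : s.Agree c s') {d : ℕ} (hd : c ≤ d) (v : ℕ) : s.Agree c (s'.set d v) :=
  ⟨fun a ha => by rw [Store.mem_set, if_neg (by omega), h.mem a ha], h.reg_zero, h.reg_one, h.out⟩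

theorem Store.Agree.setReg (h : s.Agree c s') {d : ℕ} (hd : 2 ≤ d) (x : ℝ) :
    s.Agree c (s'.setReg d x) :=
  ⟨h.mem, by rw [Store.reg_setReg, if_neg (by omega), h.reg_zero],
    by rw [Store.reg_setReg, if_neg (by omega), h.reg_one], h.out⟩

theorem Program.den_affine {d x k o : ℕ} (hd : d ≠ 50) (hx : x ≠ 50)
    (h : s.mem x * k + o < 2 ^ b) :
    (Program.affine d x k o).den b S s = (s.set 50 (o % 2 ^ b)).set d (s.mem x * k + o) := by
  simp only [affine, block, den, WordOp.value, Store.set, Store.mk.injEq, and_true]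
  funext a
  rcases eq_or_ne a d with rfl | ha
  · simp [hd, hx, Nat.mod_eq_of_lt h]
  · rcases eq_or_ne a 50 with rfl | ha'
    · simp [hd.symm]
    · simp [ha, ha']

theorem Program.den_seq (p p' : Program) (s : Store) :
    (Program.seq p p').den b S s = p'.den b S (p.den b S s) := rfl

theorem Program.loopFree_affine (d x k o : ℕ) : (Program.affine d x k o).LoopFree := by
  simp [affine, block, LoopFree]

end

/-! ### Deciding whether a block contains a hit -/

section
variable {b : ℕ} {S : DataStructure} {s : Store}

open Program

/-- Nested subprograms use increasingly high scratch cells. Each specification asserts agreement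
below its own threshold, which protects the counters of the enclosing repetitions; cell `25`
accumulates the answer. -/
theorem Program.den_compareWord (hm : s.mem 27 + 1 < 2 ^ b) (hb : 1 < 2 ^ b) :
    s.Agree 25 (compareWord.den b S s) ∧
    (compareWord.den b S s).mem 27 = s.mem 27 + 1 ∧
    (compareWord.den b S s).mem 26 = s.mem 26 ∧
    ((compareWord.den b S s).mem 25 ≠ 0 ↔ s.mem 25 ≠ 0 ∨ S.word (s.mem 27) = s.mem 26) := by
  simp only [compareWord, block, den_seq]
  generalize h1 : den b S (.fetch 28 27) s = s1
  generalize h2 : den b S (.op .eq 28 28 26) s1 = s2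
  generalize h3 : den b S (.ite 28 (.const 25 1) .skip) s2 = s3
  simp only [den, WordOp.value] at h1 h2 h3
  have a2 : s.Agree 25 s2 := by
    rw [← h2, ← h1]; exact ((Store.Agree.refl 25 s).set (by decide) _).set (by decide) _
  have m27 : s2.mem 27 = s.mem 27 := by simp [← h2, ← h1, Store.mem_set]
  have m26 : s2.mem 26 = s.mem 26 := by simp [← h2, ← h1, Store.mem_set]
  have m25 : s2.mem 25 = s.mem 25 := by simp [← h2, ← h1, Store.mem_set]
  have m28 : s2.mem 28 = if S.word (s.mem 27) = s.mem 26 then 1 else 0 := by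
    simp [← h2, ← h1, Store.mem_set]
  have a3 : s.Agree 25 s3 := by
    rw [← h3]; split
    exacts [a2, a2.set (by decide) _]
  have m27' : s3.mem 27 = s.mem 27 := by
    rw [← h3]; split <;> simp [Store.mem_set, m27]
  rw [den_affine (by decide) (by decide) (by omega)]
  refine ⟨(a3.set (by decide) _).set (by decide) _, by simp [Store.mem_set, m27'], ?_, ?_⟩
  · rw [Store.mem_set, if_neg (by decide), Store.mem_set, if_neg (by decide), ← h3]
    split <;> simp [Store.mem_set, m26]
  · simp only [Store.mem_set, ← h3]
    by_cases hw : S.word (s.mem 27) = s.mem 26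
    · simp [m28, hw, Store.mem_set, Nat.mod_eq_of_lt hb]
    · simp [m28, hw, m25]

theorem exists_lt_succ_iff {P : ℕ → Prop} {t : ℕ} :
    (∃ u < t + 1, P u) ↔ (∃ u < t, P u) ∨ P t := by
  constructor
  · rintro ⟨u, hu, h⟩
    rcases Nat.lt_succ_iff_lt_or_eq.1 hu with hu | rfl
    exacts [.inl ⟨u, hu, h⟩, .inr h]
  · rintro (⟨u, hu, h⟩ | h)
    exacts [⟨u, by omega, h⟩, ⟨t, by omega, h⟩]

theorem Program.repeat_compareWord {m : ℕ} (hm : s.mem 27 + m < 2 ^ b) (hb : 1 < 2 ^ b) :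
    s.Agree 25 ((compareWord.repeat m).den b S s) ∧
    (((compareWord.repeat m).den b S s).mem 25 ≠ 0 ↔
      s.mem 25 ≠ 0 ∨ ∃ u < m, S.word (s.mem 27 + u) = s.mem 26) := by
  have inv := den_repeat_invariant (b := b) (S := S) (m := m) (p := compareWord)
    (fun t s' => s.Agree 25 s' ∧
    s'.mem 27 = s.mem 27 + t ∧ s'.mem 26 = s.mem 26 ∧ (s'.mem 25 ≠ 0 ↔
      s.mem 25 ≠ 0 ∨ ∃ u < t, S.word (s.mem 27 + u) = s.mem 26))
    ⟨.refl _ _, rfl, rfl, by simp⟩ ?_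
  · exact ⟨inv.1, inv.2.2.2⟩
  rintro t ht s' ⟨h1, h2, h3, h4⟩
  obtain ⟨g1, g2, g3, g4⟩ := den_compareWord (S := S) (s := s') (b := b) (by omega) hb
  exact ⟨h1.trans g1, by omega, g3.trans h3, by rw [g4, h4, exists_lt_succ_iff, h2, h3, or_assoc]⟩

theorem Program.den_searchWord {r : ℕ} (hm : s.mem 24 + 1 < 2 ^ b)
    (hr : s.mem 22 + r < 2 ^ b) (hb : 1 < 2 ^ b) :
    s.Agree 24 ((searchWord r).den b S s) ∧
    ((searchWord r).den b S s).mem 24 = s.mem 24 + 1 ∧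
    (((searchWord r).den b S s).mem 25 ≠ 0 ↔ s.mem 25 ≠ 0 ∨
      ∃ v < r, S.word (s.mem 22 + v) = S.word (s.mem 24)) := by
  simp only [searchWord, block, den_seq]
  generalize h1 : den b S (.fetch 26 24) s = s1
  simp only [den] at h1
  have m22 : s1.mem 22 = s.mem 22 := by simp [← h1, Store.mem_set]
  generalize h2 : den b S (.affine 27 22 1 0) s1 = s2
  rw [den_affine (by decide) (by decide) (by omega)] at h2
  have m22 : s2.mem 22 = s.mem 22 := by simp [← h2, ← h1, Store.mem_set]
  have m24 : s2.mem 24 = s.mem 24 := by simp [← h2, ← h1, Store.mem_set]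
  have m25 : s2.mem 25 = s.mem 25 := by simp [← h2, ← h1, Store.mem_set]
  have m26 : s2.mem 26 = S.word (s.mem 24) := by simp [← h2, ← h1, Store.mem_set]
  have m27 : s2.mem 27 = s.mem 22 := by simp [← h2, ← h1, Store.mem_set]
  have a2 : s.Agree 24 s2 := by
    rw [← h2, ← h1]
    exact (((Store.Agree.refl 24 s).set (by decide) _).set (by decide) _).set (by decide) _
  obtain ⟨g1, g4⟩ := repeat_compareWord (b := b) (S := S) (s := s2) (m := r) (by omega) hb
  have g24 := g1.mem 24 (by decide)
  rw [den_affine (by decide) (by decide) (by omega)]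
  refine ⟨((a2.trans (g1.of_le (by decide))).set (by decide) _).set (by decide) _, ?_, ?_⟩
  · simp [Store.mem_set, g24, m24]
  · simp only [Store.mem_set]
    rw [m25, m26, m27] at g4
    exact g4

theorem Program.repeat_searchWord {r m : ℕ} (hm : s.mem 24 + m < 2 ^ b)
    (hr : s.mem 22 + r < 2 ^ b) (hb : 1 < 2 ^ b) (h0 : s.mem 25 = 0) :
    s.Agree 24 (((searchWord r).repeat m).den b S s) ∧
    ((((searchWord r).repeat m).den b S s).mem 25 ≠ 0 ↔
      ∃ u < m, ∃ v < r, S.word (s.mem 22 + v) = S.word (s.mem 24 + u)) := by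
  have inv := den_repeat_invariant (b := b) (S := S) (m := m) (p := searchWord r)
    (fun t s' => s.Agree 24 s' ∧
    s'.mem 24 = s.mem 24 + t ∧ (s'.mem 25 ≠ 0 ↔
      ∃ u < t, ∃ v < r, S.word (s.mem 22 + v) = S.word (s.mem 24 + u)))
    ⟨.refl _ _, rfl, by simp [h0]⟩ ?_
  · exact ⟨inv.1, inv.2.2⟩
  rintro t ht s' ⟨h1, h2, h3⟩
  have m22 := h1.mem 22 (by decide)
  obtain ⟨g1, g2, g3⟩ := den_searchWord (S := S) (s := s') (b := b) (r := r) (by omega)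
    (by omega) hb
  exact ⟨h1.trans g1, by omega, by rw [g3, h3, exists_lt_succ_iff, h2, m22]⟩

/-- Comparison of words decides whether two paths have a common inner vertex. -/
theorem Layout.disjoint_interior_iff (D : Layout) {r a a' i i' : ℕ}
    (h : ∀ t < r, S.word (a + t) = D.vert i (t + 1))
    (h' : ∀ t < r, S.word (a' + t) = D.vert i' (t + 1)) :
    Disjoint (D.interior r i') (D.interior r i) ↔
      ¬ ∃ u < r, ∃ v < r, S.word (a + v) = S.word (a' + u) := by
  simp only [interior, Finset.disjoint_left, Finset.mem_image, Finset.mem_range]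
  constructor
  · rintro hd ⟨u, hu, v, hv, e⟩
    exact hd ⟨u, hu, rfl⟩ ⟨v, hv, by rw [← h v hv, ← h' u hu, e]⟩
  · rintro hd x ⟨u, hu, rfl⟩ ⟨v, hv, e⟩
    exact hd ⟨u, hu, v, hv, by rw [h v hv, h' u hu, e]⟩

theorem Layout.record_lt {K N L m j k : ℕ} (hm : m < L) (hj : j < N) (hk : k < K) :
    (m * N + j) * K + k < L * N * K := by
  have h1 : m * N + j + 1 ≤ L * N := by
    have : (m + 1) * N ≤ L * N := Nat.mul_le_mul_right _ hm
    rw [add_mul] at this; omega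
  have h2 : (m * N + j + 1) * K ≤ L * N * K := Nat.mul_le_mul_right _ h1
  rw [add_mul _ 1] at h2
  omega

theorem Layout.Stored.lt_of_record {D : Layout} {K r b q : ℕ} {S : DataStructure}
    (h : D.Stored K r b S) (hq : q < D.levels * D.N * K) : q * (r + 8) + (r + 8) < 2 ^ b :=
  lt_of_le_of_lt (by rw [← add_one_mul]; exact Nat.mul_le_mul_right _ hq) h.bound

theorem Layout.levels_pos {D : Layout} (h : 0 < D.N) : 0 < D.levels := by
  rw [levels]; exact Nat.size_pos.2 h

/-- A block of length one has a single member, so at level 0 every slot describes the path itself.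
The vertices of a given path are read there. -/
theorem Layout.Valid.rep_zero {D : Layout} {K r j s : ℕ} (h : D.Valid K r) (hj : j < D.N)
    (hs : s < K) : D.rep 0 j s = j := by
  have := h.rep_mem 0 j s (by simpa using hj) hs
  simp at this; omega

/-- The disjunction with the old content of cell `13` lets the `K` slots of a block be accumulated
by repetition. -/
theorem Program.den_checkRecord {D : Layout} {K r : ℕ} (hS : D.Stored K r b S) {m j k p : ℕ}
    (hm : m < D.levels) (hj : j < D.N) (hk : k < K) (hq : s.mem 20 = (m * D.N + j) * K + k)
    (hr : s.mem 22 + r < 2 ^ b) (hp : ∀ t < r, S.word (s.mem 22 + t) = D.vert p (t + 1)) :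
    s.Agree 13 ((checkRecord r).den b S s) ∧
    ((checkRecord r).den b S s).mem 20 = s.mem 20 + 1 ∧
    ((checkRecord r).den b S s).mem 22 = s.mem 22 ∧
    (((checkRecord r).den b S s).mem 13 ≠ 0 ↔ s.mem 13 ≠ 0 ∨
      (Disjoint (D.interior r (D.rep m j k)) (D.interior r p) ∧
        D.top (D.rep m j k) ≤ s.reg 1)) := by
  have hQ := hS.lt_of_record (Layout.record_lt hm hj hk)
  have hb : 1 < 2 ^ b := lt_of_le_of_lt (by omega) hS.bound'
  have hS' : S.real (s.mem 20 * 3 + 2) = D.top (D.rep m j k) := by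
    rw [hq]; exact hS.real_top m j k hm hj hk
  have hV : ∀ t < r, S.word (s.mem 20 * (r + 8) + 7 + t) = D.vert (D.rep m j k) (t + 1) := by
    intro t ht
    rw [hq, ← hS.word_vert m j k (t + 1) hm hj hk (by omega)]
    congr 1; ring
  rw [← hq] at hQ
  have hq8 : s.mem 20 ≤ s.mem 20 * (r + 8) := Nat.le_mul_of_pos_right _ (by omega)
  rw [D.disjoint_interior_iff hp hV, ← hS']
  simp only [checkRecord, block, den_seq]
  generalize h1 : den b S (.affine 21 20 3 2) s = s1
  generalize h2 : den b S (.fetchReal 2 21) s1 = s2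
  generalize h3 : den b S (.leReal 23 2 1) s2 = s3
  rw [den_affine (by decide) (by decide) (by nlinarith)] at h1
  simp only [den] at h2 h3
  have m20 : s3.mem 20 = s.mem 20 := by simp [← h3, ← h2, ← h1, Store.mem_set]
  generalize h4 : den b S (.affine 24 20 (r + 8) 7) s3 = s4
  rw [den_affine (by decide) (by decide) (by rw [m20]; omega), m20] at h4
  generalize h5 : den b S (.const 25 0) s4 = s5
  simp only [den, Nat.zero_mod] at h5
  have a5 : s.Agree 21 s5 := by
    rw [← h5, ← h4, ← h3, ← h2, ← h1]
    exact (((((((Store.Agree.refl 21 s).set (by decide) _).set (by decide) _).setReg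
      (by decide) _).set (by decide) _).set (by decide) _).set (by decide) _).set (by decide) _
  have m22 : s5.mem 22 = s.mem 22 := by simp [← h5, ← h4, ← h3, ← h2, ← h1, Store.mem_set]
  have m24 : s5.mem 24 = s.mem 20 * (r + 8) + 7 := by
    simp [← h5, ← h4, Store.mem_set]
  have m25 : s5.mem 25 = 0 := by simp [← h5, Store.mem_set]
  have m23 : s5.mem 23 = if S.real (s.mem 20 * 3 + 2) ≤ s.reg 1 then 1 else 0 := by
    simp [← h5, ← h4, ← h3, ← h2, ← h1, Store.mem_set, Store.reg_setReg]
  obtain ⟨g1, g2⟩ := repeat_searchWord (b := b) (S := S) (s := s5) (m := r) (r := r) (by omega)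
    (by omega) hb m25
  rw [m22, m24] at g2
  generalize h6 : den b S ((searchWord r).repeat r) s5 = s6 at *
  have a6 := a5.trans (g1.of_le (by decide))
  have n22 := (g1.mem 22 (by decide)).trans m22
  have n23 := (g1.mem 23 (by decide)).trans m23
  have n13 := a6.mem 13 (by decide)
  have n20 := a6.mem 20 (by decide)
  generalize h7 : den b S (.ite 25 .skip (.ite 23 (.const 13 1) .skip)) s6 = s7
  simp only [den, Nat.mod_eq_of_lt hb] at h7
  have a7 : s.Agree 13 s7 := by
    rw [← h7]
    split_ifs
    exacts [a6.of_le (by decide), (a6.of_le (by decide)).set (by decide) _, a6.of_le (by decide)]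
  have m20 : s7.mem 20 = s.mem 20 := by
    rw [← h7]; split_ifs <;> simp [Store.mem_set, n20]
  have m22 : s7.mem 22 = s.mem 22 := by
    rw [← h7]; split_ifs <;> simp [Store.mem_set, n22]
  rw [den_affine (by decide) (by decide) (by omega)]
  refine ⟨(a7.set (by decide) _).set (by decide) _, by simp [Store.mem_set, m20],
    by simp [Store.mem_set, m22], ?_⟩
  rw [Store.mem_set, if_neg (by decide), Store.mem_set, if_neg (by decide), ← g2, ← h7]
  by_cases e1 : s6.mem 25 = 0
  · by_cases e2 : S.real (s.mem 20 * 3 + 2) ≤ s.reg 1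
    · rw [if_pos e2] at n23
      simp [e1, n23, Store.mem_set, e2]
    · rw [if_neg e2] at n23
      simp [e1, n23, n13, e2]
  · simp [e1, n13]

/-- The program sees only the `K` representatives, while the conclusion speaks of all paths of the
block. A successful representative lies in the block by `rep_mem`; conversely `rep_spec`, applied to
the at most r inner vertices of the current path, turns any hit into a stored one. -/
theorem Program.den_innerCheck {D : Layout} {K r : ℕ} (hS : D.Stored K r b S) (hD : D.Valid K r)
    {m : ℕ} (hm : m < D.levels) (hj : s.mem 5 + 2 ^ m ≤ s.mem 6) (hp : s.mem 6 < D.N)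
    (hrow : s.mem 11 = m * D.N) :
    s.Agree 13 ((innerCheck K r).den b S s) ∧
    (((innerCheck K r).den b S s).mem 13 ≠ 0 ↔ ∃ i, s.mem 5 ≤ i ∧ i < s.mem 5 + 2 ^ m ∧
      Disjoint (D.interior r i) (D.interior r (s.mem 6)) ∧ D.top i ≤ s.reg 1) := by
  have hK := hD.K_pos
  have h2m : 0 < 2 ^ m := by positivity
  have hjN : s.mem 5 < D.N := by omega
  have hQ := hS.lt_of_record (Layout.record_lt hm hjN hK)
  have hP := hS.lt_of_record (Layout.record_lt (Layout.levels_pos (by omega)) hp hK)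
  have eP : (0 * D.N + s.mem 6) * K + 0 = s.mem 6 * K := by ring
  rw [eP] at hP
  have eP' : s.mem 6 * (K * (r + 8)) = s.mem 6 * K * (r + 8) := by ring
  have hq8 : (m * D.N + s.mem 5) * K + 0 ≤ ((m * D.N + s.mem 5) * K + 0) * (r + 8) :=
    Nat.le_mul_of_pos_right _ (by omega)
  have hqK : m * D.N + s.mem 5 ≤ (m * D.N + s.mem 5) * K := Nat.le_mul_of_pos_right _ hK
  simp only [innerCheck, block, den_seq]
  generalize h1 : den b S (.affine 22 6 (K * (r + 8)) 7) s = s1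
  generalize h2 : den b S (.op .add 20 11 5) s1 = s2
  rw [den_affine (by decide) (by decide) (by omega)] at h1
  simp only [den, WordOp.value] at h2
  have m20 : s2.mem 20 = m * D.N + s.mem 5 := by
    simp only [← h2, ← h1, Store.mem_set]; simp [hrow]; exact Nat.mod_eq_of_lt (by omega)
  generalize h3 : den b S (.affine 20 20 K 0) s2 = s3
  rw [den_affine (by decide) (by decide) (by rw [m20]; omega), m20] at h3
  generalize h4 : den b S (.const 13 0) s3 = s4
  simp only [den, Nat.zero_mod] at h4
  have a4 : s.Agree 13 s4 := by
    rw [← h4, ← h3, ← h2, ← h1]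
    exact ((((((Store.Agree.refl 13 s).set (by decide) _).set (by decide) _).set (by decide) _).set
      (by decide) _).set (by decide) _).set (by decide) _
  have m22 : s4.mem 22 = s.mem 6 * K * (r + 8) + 7 := by
    simp [← h4, ← h3, ← h2, ← h1, Store.mem_set, eP']
  have m20 : s4.mem 20 = (m * D.N + s.mem 5) * K := by simp [← h4, ← h3, Store.mem_set]
  have m13 : s4.mem 13 = 0 := by simp [← h4, Store.mem_set]
  clear h1 h2 h3 h4
  have inv := den_repeat_invariant (b := b) (S := S) (m := K) (p := checkRecord r) (s := s4)
    (fun t s' => s.Agree 13 s' ∧ s'.mem 20 = (m * D.N + s.mem 5) * K + t ∧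
      s'.mem 22 = s.mem 6 * K * (r + 8) + 7 ∧ (s'.mem 13 ≠ 0 ↔ ∃ u < t,
        (Disjoint (D.interior r (D.rep m (s.mem 5) u)) (D.interior r (s.mem 6)) ∧
        D.top (D.rep m (s.mem 5) u) ≤ s.reg 1)))
    ⟨a4, m20, m22, by simp [m13]⟩ (by
      rintro t ht s' ⟨h1, h2, h3, h4⟩
      obtain ⟨g1, g2, g3, g4⟩ := den_checkRecord hS (s := s') (p := s.mem 6) hm hjN ht h2 (by omega)
        (by
          intro t ht
          have hv := hS.word_vert 0 (s.mem 6) 0 (t + 1) (Layout.levels_pos (by omega)) hp hK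
            (by omega)
          rw [hD.rep_zero hp hK] at hv
          rw [h3, ← hv]
          congr 1; ring)
      refine ⟨h1.trans g1, by omega, by omega, ?_⟩
      rw [g4, h4, exists_lt_succ_iff, h1.reg_one])
  refine ⟨inv.1, inv.2.2.2.trans ?_⟩
  have hjN' : s.mem 5 + 2 ^ m ≤ D.N := by omega
  constructor
  · rintro ⟨u, hu, h1, h2⟩
    exact ⟨_, (hD.rep_mem m _ u hjN' hu).1, (hD.rep_mem m _ u hjN' hu).2, h1, h2⟩
  · rintro ⟨i, hi1, hi2, h1, h2⟩
    obtain ⟨u, hu, h3, h4⟩ := hD.rep_spec m _ _ i hjN'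
      (Finset.card_image_le.trans (Finset.card_range r).le) hi1 hi2 h1
    exact ⟨u, hu, h3, h4.trans h2⟩

/-- One comparison with a stored minimum settles the whole block, by `need_spec`. -/
theorem Program.den_outerCheck {D : Layout} {K r : ℕ} (hS : D.Stored K r b S) (hD : D.Valid K r)
    {m : ℕ} (hm : m < D.levels) (hj : s.mem 4 + 2 ^ m ≤ D.Nout) (hrow : s.mem 11 = m * D.N) :
    s.Agree 13 ((outerCheck K).den b S s) ∧
    (((outerCheck K).den b S s).mem 13 ≠ 0 ↔ ∃ i, s.mem 4 ≤ i ∧ i < s.mem 4 + 2 ^ m ∧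
      D.need 0 i ≤ s.reg 1) := by
  have hK := hD.K_pos
  have h2m : 0 < 2 ^ m := by positivity
  have hjN : s.mem 4 < D.N := by have := hD.Nout_le; omega
  have hQ := hS.lt_of_record (Layout.record_lt hm hjN hK)
  have hqK : m * D.N + s.mem 4 ≤ (m * D.N + s.mem 4) * K := Nat.le_mul_of_pos_right _ hK
  have e3 : (m * D.N + s.mem 4) * (3 * K) = (m * D.N + s.mem 4) * K * 3 := by ring
  simp only [outerCheck, block, den_seq]
  generalize h1 : den b S (.op .add 20 11 4) s = s1
  simp only [den, WordOp.value, hrow] at h1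
  rw [Nat.mod_eq_of_lt (by nlinarith)] at h1
  have m20 : s1.mem 20 = m * D.N + s.mem 4 := by simp [← h1, Store.mem_set]
  generalize h2 : den b S (.affine 21 20 (3 * K) 1) s1 = s2
  rw [den_affine (by decide) (by decide) (by rw [m20]; nlinarith), m20] at h2
  have m21 : s2.mem 21 = (m * D.N + s.mem 4) * (3 * K) + 1 := by simp [← h2, Store.mem_set]
  simp only [den, m21]
  rw [hS.real_need m _ hm hjN]
  constructor
  · rw [← h2, ← h1]
    exact (((((Store.Agree.refl 13 s).set (by decide) _).set (by decide) _).set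
      (by decide) _).setReg (by decide) _).set (by decide) _
  · rw [← hD.need_spec m _ _ hj]
    simp [Store.mem_set, Store.reg_setReg, ← h2, ← h1]

end

/-! ### Binary lifting -/

section
variable {b : ℕ} {S : DataStructure} {s : Store}

open Program

/-- `s'` differs from `s` only in cell `d`, in scratch cells and in scratch registers. -/
structure Store.AgreeOff (d : ℕ) (s s' : Store) : Prop where
  mem : ∀ a < 10, a ≠ d → s'.mem a = s.mem a
  reg_zero : s'.reg 0 = s.reg 0
  reg_one : s'.reg 1 = s.reg 1
  out : s'.out = s.out

theorem Store.AgreeOff.trans_agree {d : ℕ} {s s' s'' : Store} (h : s.AgreeOff d s')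
    (h' : s'.Agree 10 s'') : s.AgreeOff d s'' :=
  ⟨fun a ha had => (h'.mem a ha).trans (h.mem a ha had), h'.reg_zero.trans h.reg_zero,
    h'.reg_one.trans h.reg_one, h'.out.trans h.out⟩

theorem Store.AgreeOff.set {d : ℕ} {s s' : Store} (h : s.AgreeOff d s') {a : ℕ}
    (ha : a = d ∨ 10 ≤ a) (v : ℕ) : s.AgreeOff d (s'.set a v) :=
  ⟨fun x hx hxd => by rw [Store.mem_set, if_neg (by omega), h.mem x hx hxd], h.reg_zero,
    h.reg_one, h.out⟩

theorem Program.LoopFree.liftStep {chk : Program} (h : chk.LoopFree) (d e : ℕ) :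
    (liftStep chk d e).LoopFree := by
  simp [Program.liftStep, block, LoopFree, affine, h]

/-- One step of binary lifting. -/
theorem Program.den_liftStep {chk : Program} {d e : ℕ} {ok : ℕ → Prop} {m : ℕ} (hd : d < 10)
    (he : e < 10) (hd0 : d ≠ 0) (hb : 2 < 2 ^ b) (hj : s.mem d + s.mem 10 < 2 ^ b)
    (h10 : s.mem 10 = 2 ^ m)
    (hchk : ∀ s', s.Agree 12 s' → s.mem d + 2 ^ m ≤ s.mem e → s'.Agree 13 (chk.den b S s') ∧
      ((chk.den b S s').mem 13 ≠ 0 ↔ ∃ i, s.mem d ≤ i ∧ i < s.mem d + 2 ^ m ∧ ok i)) :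
    s.AgreeOff d ((liftStep chk d e).den b S s) ∧
    ((liftStep chk d e).den b S s).mem 10 = s.mem 10 / 2 ∧
    ((liftStep chk d e).den b S s).mem 11 = s.mem 11 - s.mem 0 ∧
    ((s.mem d + 2 ^ m ≤ s.mem e ∧ (∀ i, s.mem d ≤ i → i < s.mem d + 2 ^ m → ¬ ok i) ∧
      ((liftStep chk d e).den b S s).mem d = s.mem d + 2 ^ m) ∨
    ((s.mem e < s.mem d + 2 ^ m ∨ ∃ i, s.mem d ≤ i ∧ i < s.mem d + 2 ^ m ∧ ok i) ∧
      ((liftStep chk d e).den b S s).mem d = s.mem d)) := by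
  -- The descent by one level is the same in all three outcomes: the block exceeds the limit,
  -- contains a hit, or is skipped.
  have hlast : ∀ s' : Store, s.AgreeOff d s' → s'.mem 10 = s.mem 10 → s'.mem 11 = s.mem 11 →
      ∃ s'', (op .sub 11 11 0).den b S ((op .div 10 10 50).den b S ((const 50 2).den b S s')) = s'' ∧
        s.AgreeOff d s'' ∧ s''.mem 10 = s.mem 10 / 2 ∧ s''.mem 11 = s.mem 11 - s.mem 0 ∧
        s''.mem d = s'.mem d := by
    intro s' h h10 h11
    refine ⟨_, rfl, ?_, ?_, ?_, ?_⟩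
    · exact ((h.set (by omega) _).set (by omega) _).set (by omega) _
    · simp [den, WordOp.value, Store.mem_set, h10, Nat.mod_eq_of_lt hb]
    · simp [den, WordOp.value, Store.mem_set, h11, h.mem 0 (by decide) hd0.symm]
    · simp only [den, Store.mem_set]
      rw [if_neg (by omega), if_neg (by omega), if_neg (by omega)]
  simp only [liftStep, block, den_seq]
  generalize h1 : den b S (.op .add 12 d 10) s = s1
  simp only [den, WordOp.value, Nat.mod_eq_of_lt hj] at h1
  generalize h2 : den b S (.op .lt 13 e 12) s1 = s2
  simp only [den, WordOp.value] at h2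
  have a2 : s.Agree 12 s2 := by
    rw [← h2, ← h1]; exact ((Store.Agree.refl 12 s).set (by decide) _).set (by decide) _
  have m12 : s2.mem 12 = s.mem d + 2 ^ m := by simp [← h2, ← h1, Store.mem_set, h10]
  have m13 : s2.mem 13 = if s.mem e < s.mem d + 2 ^ m then 1 else 0 := by
    simp only [← h2, ← h1, Store.mem_set, if_true, h10]
    rw [if_neg (show e ≠ 12 by omega)]
  clear h1 h2
  have o2 : s.AgreeOff d s2 :=
    ⟨fun a ha _ => a2.mem a (by omega), a2.reg_zero, a2.reg_one, a2.out⟩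
  generalize h3 : den b S (.ite 13 .skip (.seq chk (.ite 13 .skip (.affine d 12 1 0)))) s2 = s3
  by_cases hE : s.mem e < s.mem d + 2 ^ m
  · rw [if_pos hE] at m13
    have : s3 = s2 := by rw [← h3]; simp [den, m13]
    subst this
    obtain ⟨s'', e'', g1, g2, g3, g4⟩ := hlast s3 o2 (a2.mem _ (by decide)) (a2.mem _ (by decide))
    rw [e'']
    exact ⟨g1, g2, g3, .inr ⟨.inl hE, g4.trans (a2.mem _ (by omega))⟩⟩
  · rw [if_neg hE] at m13
    rw [not_lt] at hE
    obtain ⟨c1, c2⟩ := hchk s2 a2 hE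
    simp only [den, m13, if_true] at h3
    generalize hs' : den b S chk s2 = s' at *
    have o' := o2.trans_agree (c1.of_le (by decide))
    by_cases hc : s'.mem 13 = 0
    · rw [if_pos hc] at h3
      have n12 := (c1.mem 12 (by decide)).trans m12
      rw [den_affine (by omega) (by decide) (by rw [n12]; omega), n12] at h3
      obtain ⟨s'', e'', g1, g2, g3, g4⟩ := hlast s3
        (by rw [← h3]; exact (o'.set (by omega) _).set (by omega) _)
        (by rw [← h3, Store.mem_set, if_neg (by omega), Store.mem_set, if_neg (by decide),
              c1.mem 10 (by decide), a2.mem 10 (by decide)])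
        (by rw [← h3, Store.mem_set, if_neg (by omega), Store.mem_set, if_neg (by decide),
              c1.mem 11 (by decide), a2.mem 11 (by decide)])
      rw [e'']
      refine ⟨g1, g2, g3, .inl ⟨hE, fun i hi hi' hok => ?_, ?_⟩⟩
      · exact absurd hc (c2.2 ⟨i, hi, hi', hok⟩)
      · rw [g4, ← h3, Store.mem_set, if_pos rfl]; ring
    · rw [if_neg hc] at h3
      subst h3
      obtain ⟨s'', e'', g1, g2, g3, g4⟩ := hlast s' o'
        ((c1.mem 10 (by decide)).trans (a2.mem 10 (by decide)))
        ((c1.mem 11 (by decide)).trans (a2.mem 11 (by decide)))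
      rw [e'']
      exact ⟨g1, g2, g3, .inr ⟨.inr (c2.1 hc),
        g4.trans ((c1.mem d (by omega)).trans (a2.mem d (by omega)))⟩⟩

/-- The running time of `findNext` on a table with `L` levels. -/
def Program.findNextTime (chk : Program) (d e L : ℕ) : ℕ :=
  20 + (L * ((liftStep chk d e).cost + 1) + 1) + 1

/-- Let f be the first hit, or the limit `M[e]` if there is none. The invariant with m levels left
is M[d] ≤ f < M[d] + 2^m. A block is skipped only if it ends by the limit and is free of hits, so f
lies beyond it; otherwise f lies inside it. Either way the window is halved, and m = 0 forces M[d] =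
f. -/
theorem Program.eval_findNext {chk : Program} {d e N L : ℕ} {ok : ℕ → Prop} (hchk0 : chk.LoopFree)
    (hd : d < 10) (he : e < 10) (hde : e ≠ d) (hd0 : d ≠ 0) (hb : 2 < 2 ^ b)
    (hN : 2 * N < 2 ^ b) (hL : (L - 1) * N < 2 ^ b) (hLN : L = Nat.size N) (h0 : s.mem 0 = N)
    (h2 : s.mem 2 = 2 ^ L / 2) (h3 : s.mem 3 = (L - 1) * N) (hj : s.mem d ≤ s.mem e)
    (hE : s.mem e ≤ N)
    (hchk : ∀ s' m, s.AgreeOff d s' → m < L → s'.mem 11 = m * N → s.mem d ≤ s'.mem d →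
      s'.mem d + 2 ^ m ≤ s.mem e → s'.Agree 13 (chk.den b S s') ∧
      ((chk.den b S s').mem 13 ≠ 0 ↔ ∃ i, s'.mem d ≤ i ∧ i < s'.mem d + 2 ^ m ∧ ok i)) :
    ∃ s', Eval b S (findNext chk d e) (findNextTime chk d e L) s s' ∧ s.AgreeOff d s' ∧
      s.mem d ≤ s'.mem d ∧ s'.mem d ≤ s.mem e ∧
      (∀ i, s.mem d ≤ i → i < s'.mem d → ¬ ok i) ∧ (s'.mem d < s.mem e → ok (s'.mem d)) := by
  classical
  -- The condition is vacuous at the limit, so its least solution is the first hit or the limit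
  -- itself.
  have hex : ∃ i, s.mem d ≤ i ∧ (i < s.mem e → ok i) := ⟨s.mem e, hj, by simp⟩
  obtain ⟨f, hf, hfmin⟩ : ∃ f, (s.mem d ≤ f ∧ (f < s.mem e → ok f)) ∧
      ∀ i < f, ¬ (s.mem d ≤ i ∧ (i < s.mem e → ok i)) :=
    ⟨Nat.find hex, Nat.find_spec hex, fun i hi => Nat.find_min hex hi⟩
  have hfE : f ≤ s.mem e := by
    by_contra h
    exact hfmin _ (not_le.1 h) ⟨hj, by simp⟩
  -- `L` is the binary length of `N`. Thus N < 2^L makes the initial window contain f, and 2^L / 2 ≤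
  -- N keeps the sums M[d] + 2^m at most 2N, hence without overflow.
  have hNL : N < 2 ^ L := hLN ▸ Nat.lt_size_self N
  have hLN' : 2 ^ L / 2 ≤ N := by
    rcases Nat.eq_zero_or_pos N with h | h
    · subst h; subst hLN; simp
    · have : L - 1 < Nat.size N := by have := Nat.size_pos.2 h; omega
      have h' := Nat.lt_size.1 this
      have e : 2 ^ L = 2 ^ (L - 1) * 2 := by rw [← pow_succ]; congr 1; omega
      rw [e]; omega
  -- Cell `10` is the length of the block to be tested next, at level m - 1, and cell `11` is the
  -- offset of its row. For m = 0 the division gives 0 in cell `10`, which ends the loop; the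
  -- truncated subtraction makes cell `11` harmless.
  set I : ℕ → Store → Prop := fun m s' => m ≤ L ∧ s.AgreeOff d s' ∧ s'.mem 10 = 2 ^ m / 2 ∧
    s'.mem 11 = (m - 1) * N ∧ s.mem d ≤ s'.mem d ∧ s'.mem d ≤ f ∧ f < s'.mem d + 2 ^ m with hI
  have hstart : ∃ s₁, Eval b S (.block [.affine 10 2 1 0, .affine 11 3 1 0]) 20 s s₁ ∧ I L s₁ := by
    refine ⟨_, (LoopFree.eval (by simp [block, LoopFree, affine]) s).mono
      (by simp [block, cost, affine]), ?_⟩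
    simp only [block, den_seq]
    rw [den_affine (s := s) (by decide) (by decide) (by omega)]
    rw [den_affine (by decide) (by decide) (by simp [Store.mem_set]; omega)]
    refine ⟨le_rfl, ?_, by simp [Store.mem_set, h2], by simp [Store.mem_set, h3], ?_⟩
    · exact ((((⟨fun _ _ _ => rfl, rfl, rfl, rfl⟩ : s.AgreeOff d s).set (by omega) _).set
        (by omega) _).set (by omega) _).set (by omega) _
    · have : ∀ v1 v2 v3 v4, ((((s.set 50 v1).set 10 v2).set 50 v3).set 11 v4).mem d = s.mem d := by
        intros; simp only [Store.mem_set]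
        rw [if_neg (by omega), if_neg (by omega), if_neg (by omega), if_neg (by omega)]
      rw [this]
      exact ⟨le_rfl, hf.1, by omega⟩
  obtain ⟨s₁, ev₁, hI₁⟩ := hstart
  have hstep : ∀ m s', I (m + 1) s' → s'.mem 10 ≠ 0 ∧ I m ((liftStep chk d e).den b S s') := by
    rintro m s' ⟨g1, g2, g3, g4, g5, g6, g7⟩
    have g3' : s'.mem 10 = 2 ^ m := by rw [g3, pow_succ]; simp
    have g4' : s'.mem 11 = m * N := by simpa using g4
    have he' := g2.mem e he hde
    have h0' := g2.mem 0 (by decide) hd0.symm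
    have hm2 : 2 ^ m ≤ 2 ^ L / 2 := by
      rw [Nat.le_div_iff_mul_le (by decide), ← pow_succ]; exact Nat.pow_le_pow_right (by decide) g1
    have key := den_liftStep (b := b) (S := S) (s := s') (chk := chk) (d := d) (e := e) (ok := ok)
      (m := m) hd he hd0 hb (by omega) g3' (by
        intro s'' hs'' hle
        have hd' := hs''.mem d (by omega)
        have := hchk s'' m (g2.trans_agree (hs''.of_le (by decide))) (by omega)
          ((hs''.mem 11 (by decide)).trans g4') (by rw [hd']; exact g5) (by rw [hd']; omega)
        rwa [hd'] at this)
    obtain ⟨k1, k2, k3, k4⟩ := key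
    refine ⟨by rw [g3']; positivity, by omega, ?_, by rw [k2, g3'], ?_, ?_⟩
    · exact ⟨fun a ha had => (k1.mem a ha had).trans (g2.mem a ha had),
        k1.reg_zero.trans g2.reg_zero, k1.reg_one.trans g2.reg_one, k1.out.trans g2.out⟩
    · rw [k3, g4', h0', h0, Nat.sub_mul, one_mul]
    · rw [pow_succ] at g7
      rcases k4 with ⟨c1, c2, c3⟩ | ⟨c1, c3⟩
      · rw [c3]
        have : s'.mem d + 2 ^ m ≤ f := by
          by_contra hlt
          rcases lt_or_eq_of_le hfE with h | h
          · exact c2 f g6 (by omega) (hf.2 h)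
          · omega
        omega
      · rw [c3]
        refine ⟨g5, g6, ?_⟩
        rcases c1 with c1 | ⟨i, c1, c2, c4⟩
        · by_contra hlt
          exact hfmin (s.mem e) (by omega) ⟨hj, by simp⟩
        · by_contra hlt
          exact hfmin i (by omega) ⟨by omega, fun _ => c4⟩
  obtain ⟨s₂, hI₂, ev₂⟩ := Eval.loop_of_invariant (b := b) (S := S) (x := 10)
    (hchk0.liftStep d e) I hstep (fun s' h => by simpa using h.2.2.1) L hI₁
  obtain ⟨-, g1, -, -, g2, g3, g4⟩ := hI₂
  have : s₂.mem d = f := by simp at g4; omega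
  rw [← this] at hf hfmin hfE
  exact ⟨s₂, ev₁.seq ev₂, g1, hf.1, hfE, fun i hi hi' hok => hfmin i hi' ⟨hi, fun _ => hok⟩, hf.2⟩

end

section
variable {b : ℕ} {S : DataStructure} {s : Store}

open Program

/-! ### Output -/

theorem Program.repeat_emit_up {m : ℕ} (hm : s.mem 20 + m < 2 ^ b) :
    (∀ a < 20, (((block [emitWord, .affine 20 20 1 1]).repeat m).den b S s).mem a = s.mem a) ∧
    (((block [emitWord, .affine 20 20 1 1]).repeat m).den b S s).reg = s.reg ∧
    (((block [emitWord, .affine 20 20 1 1]).repeat m).den b S s).out =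
      s.out ++ (List.range m).map fun u => S.word (s.mem 20 + u) := by
  have inv := den_repeat_invariant (b := b) (S := S) (m := m) (s := s)
    (p := block [emitWord, .affine 20 20 1 1])
    (fun t s' => s'.mem 20 = s.mem 20 + t ∧ (∀ a < 20, s'.mem a = s.mem a) ∧ s'.reg = s.reg ∧
      s'.out = s.out ++ (List.range t).map fun u => S.word (s.mem 20 + u))
    ⟨rfl, fun _ _ => rfl, rfl, by simp⟩ ?_
  · exact inv.2
  rintro t ht s' ⟨h1, h2, h3, h4⟩
  simp only [block, den_seq, emitWord]
  generalize e1 : den b S (.fetch 21 20) s' = s1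
  generalize e2 : den b S (.emit 21) s1 = s2
  simp only [den] at e1 e2
  have m20 : s2.mem 20 = s.mem 20 + t := by simp [← e2, ← e1, Store.mem_set, h1]
  rw [den_affine (by decide) (by decide) (by omega)]
  refine ⟨by simp [Store.mem_set, m20, add_assoc], fun a ha => ?_, ?_, ?_⟩
  · simp only [Store.mem_set, ← e2, ← e1]
    rw [if_neg (by omega), if_neg (by omega), if_neg (by omega), h2 a ha]
  · simp [← e2, ← e1, h3]
  · simp [← e2, ← e1, h4, h1, List.range_succ, Store.mem_set]

theorem Program.repeat_emit_down {m : ℕ} (hb : 1 < 2 ^ b) :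
    (∀ a < 20, (((block [emitWord, .const 50 1, .op .sub 20 20 50]).repeat m).den b S s).mem a =
      s.mem a) ∧
    (((block [emitWord, .const 50 1, .op .sub 20 20 50]).repeat m).den b S s).reg = s.reg ∧
    (((block [emitWord, .const 50 1, .op .sub 20 20 50]).repeat m).den b S s).out =
      s.out ++ (List.range m).map fun u => S.word (s.mem 20 - u) := by
  have inv := den_repeat_invariant (b := b) (S := S) (m := m) (s := s)
    (p := block [emitWord, .const 50 1, .op .sub 20 20 50])
    (fun t s' => s'.mem 20 = s.mem 20 - t ∧ (∀ a < 20, s'.mem a = s.mem a) ∧ s'.reg = s.reg ∧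
      s'.out = s.out ++ (List.range t).map fun u => S.word (s.mem 20 - u))
    ⟨rfl, fun _ _ => rfl, rfl, by simp⟩ ?_
  · exact inv.2
  rintro t ht s' ⟨h1, h2, h3, h4⟩
  simp only [block, den_seq, emitWord]
  generalize e1 : den b S (.fetch 21 20) s' = s1
  generalize e2 : den b S (.emit 21) s1 = s2
  simp only [den] at e1 e2
  have m20 : s2.mem 20 = s.mem 20 - t := by simp [← e2, ← e1, Store.mem_set, h1]
  simp only [den, WordOp.value, Nat.mod_eq_of_lt hb]
  refine ⟨by simp [Store.mem_set, m20]; omega, fun a ha => ?_, ?_, ?_⟩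
  · simp only [Store.mem_set, ← e2, ← e1]
    rw [if_neg (by omega), if_neg (by omega), if_neg (by omega), h2 a ha]
  · simp [← e2, ← e1, h3]
  · simp [← e2, ← e1, h4, h1, List.range_succ, Store.mem_set]

/-- The vertices of the cycle formed by the paths `p` and `i`, in cyclic order. -/
def Layout.cycle (D : Layout) (r p i : ℕ) : List ℕ :=
  (List.range (r + 2)).map (D.vert p) ++ (List.range r).map fun t => D.vert i (r - t)

theorem Layout.length_cycle (D : Layout) (r p i : ℕ) : (D.cycle r p i).length = 2 * (r + 1) := by
  simp [cycle]; ring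

theorem Layout.Stored.word_path {D : Layout} {K r : ℕ} (hS : D.Stored K r b S)
    (hD : D.Valid K r) {i t : ℕ} (hi : i < D.N) (ht : t < r + 2) :
    S.word (i * (K * (r + 8)) + (6 + t)) = D.vert i t := by
  have h := hS.word_vert 0 i 0 t (levels_pos (by omega)) hi hD.K_pos ht
  rw [hD.rep_zero hi hD.K_pos] at h
  rw [← h]; congr 1; ring

theorem Layout.Stored.path_lt {D : Layout} {K r : ℕ} (hS : D.Stored K r b S)
    (hD : D.Valid K r) {i : ℕ} (hi : i < D.N) : i * (K * (r + 8)) + (r + 8) < 2 ^ b := by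
  have h := hS.lt_of_record (record_lt (levels_pos (by omega)) hi hD.K_pos)
  rwa [show (0 * D.N + i) * K + 0 = i * K by ring, mul_assoc] at h

theorem Program.den_emitCycle {D : Layout} {K r : ℕ} (hS : D.Stored K r b S) (hD : D.Valid K r)
    (h5 : s.mem 5 < D.N) (h6 : s.mem 6 < D.N) :
    (∀ a < 10, a ≠ 5 → ((emitCycle K r).den b S s).mem a = s.mem a) ∧
    ((emitCycle K r).den b S s).mem 5 = s.mem 5 + 1 ∧
    ((emitCycle K r).den b S s).reg = s.reg ∧
    ((emitCycle K r).den b S s).out = s.out ++ D.cycle r (s.mem 6) (s.mem 5) := by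
  have b5 := hS.path_lt hD h5
  have b6 := hS.path_lt hD h6
  have hb := hS.bound'
  simp only [emitCycle]
  generalize hup : (Program.block [emitWord, .affine 20 20 1 1]).repeat (r + 2) = up
  generalize hdown : (Program.block [emitWord, .const 50 1, .op .sub 20 20 50]).repeat r = down
  simp only [block, den_seq]
  generalize h1 : den b S (.affine 20 6 (K * (r + 8)) 6) s = s1
  rw [den_affine (by decide) (by decide) (by omega)] at h1
  have m20 : s1.mem 20 = s.mem 6 * (K * (r + 8)) + 6 := by simp [← h1, Store.mem_set]
  have f1 : ∀ a < 20, s1.mem a = s.mem a := by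
    intro a ha
    rw [← h1, Store.mem_set, Store.mem_set, if_neg (by omega), if_neg (by omega)]
  have r1 : s1.reg = s.reg := by simp [← h1]
  have o1 : s1.out = s.out := by simp [← h1]
  have g1 := repeat_emit_up (b := b) (S := S) (s := s1) (m := r + 2) (by omega)
  rw [hup, m20, r1, o1] at g1
  generalize den b S up s1 = s2 at *
  obtain ⟨f2, r2, o2⟩ := g1
  have f2' : ∀ a < 20, s2.mem a = s.mem a := fun a ha => (f2 a ha).trans (f1 a ha)
  generalize h3 : den b S (.affine 20 5 (K * (r + 8)) (6 + r)) s2 = s3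
  rw [den_affine (by decide) (by decide) (by rw [f2' 5 (by decide)]; omega),
    f2' 5 (by decide)] at h3
  have m20 : s3.mem 20 = s.mem 5 * (K * (r + 8)) + (6 + r) := by simp [← h3, Store.mem_set]
  have f3 : ∀ a < 20, s3.mem a = s.mem a := by
    intro a ha
    rw [← h3, Store.mem_set, Store.mem_set, if_neg (by omega), if_neg (by omega), f2' a ha]
  have r3 : s3.reg = s.reg := by simp [← h3, r2]
  have o3 : s3.out = s2.out := by simp [← h3]
  have g3 := repeat_emit_down (b := b) (S := S) (s := s3) (m := r) (by omega)
  rw [hdown, m20, r3, o3, o2] at g3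
  generalize den b S down s3 = s4 at *
  obtain ⟨f4, r4, o4⟩ := g3
  have m5 := (f4 5 (by decide)).trans (f3 5 (by decide))
  rw [den_affine (by decide) (by decide) (by omega)]
  refine ⟨fun a ha h5 => ?_, by simp [Store.mem_set, m5], by simp [r4], ?_⟩
  · rw [Store.mem_set, Store.mem_set, if_neg (by omega), if_neg (by omega), f4 a (by omega),
      f3 a (by omega)]
  · simp only [Store.out_set, o4, Layout.cycle, List.append_assoc]
    congr 2
    · refine List.map_congr_left fun t ht => ?_
      rw [← hS.word_path hD h6 (List.mem_range.1 ht), add_assoc]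
    · refine List.map_congr_left fun t ht => ?_
      have ht := List.mem_range.1 ht
      rw [← hS.word_path hD h5 (show r - t < r + 2 by omega)]
      congr 1; omega

theorem Program.den_tryLoad {D : Layout} {K r : ℕ} (hS : D.Stored K r b S) (hD : D.Valid K r)
    (h4 : s.mem 4 < D.Nout) :
    ((tryLoad K r).den b S s).reg 0 = s.reg 0 ∧ ((tryLoad K r).den b S s).reg 1 = s.reg 1 ∧
    ((tryLoad K r).den b S s).out = s.out ∧
    ((s.reg 0 ≤ D.low (s.mem 4) ∧
      (∀ a < 10, a ≠ 4 → a ≠ 5 → a ≠ 6 → ((tryLoad K r).den b S s).mem a = s.mem a) ∧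
      ((tryLoad K r).den b S s).mem 4 = s.mem 4 + 1 ∧
      ((tryLoad K r).den b S s).mem 5 = D.start (s.mem 4) ∧
      ((tryLoad K r).den b S s).mem 6 = D.pos (s.mem 4)) ∨
     (¬ s.reg 0 ≤ D.low (s.mem 4) ∧ ((tryLoad K r).den b S s).mem 7 = 0)) := by
  have hN : s.mem 4 < D.N := h4.trans_le hD.Nout_le
  have b4 := hS.path_lt hD hN
  have hb := hS.bound'
  have b3 : s.mem 4 * (3 * K) ≤ s.mem 4 * (K * (r + 8)) :=
    Nat.mul_le_mul_left _ (by nlinarith [hD.K_pos])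
  simp only [tryLoad, block, den_seq]
  generalize h1 : den b S (.affine 20 4 (3 * K) 0) s = s1
  rw [den_affine (by decide) (by decide) (by omega)] at h1
  generalize h2 : den b S (.fetchReal 2 20) s1 = s2
  generalize h3 : den b S (.leReal 15 0 2) s2 = s3
  simp only [den] at h2 h3
  have a3 : s.Agree 15 s3 := by
    rw [← h3, ← h2, ← h1]
    exact ((((Store.Agree.refl 15 s).set (by decide) _).set (by decide) _).setReg
      (by decide) _).set (by decide) _
  have m15 : s3.mem 15 = if s.reg 0 ≤ D.low (s.mem 4) then 1 else 0 := by
    simp [← h3, ← h2, ← h1, Store.mem_set, Store.reg_setReg, ← hS.real_low _ hN]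
  simp only [den, m15]
  by_cases hl : s.reg 0 ≤ D.low (s.mem 4)
  · simp only [hl, if_true, one_ne_zero, if_false, not_true, false_and, or_false, true_and]
    simp only [loadPath, block, den_seq]
    have m4 := a3.mem 4 (by decide)
    rw [den_affine (s := s3) (by decide) (by decide) (by rw [m4]; omega), m4]
    generalize k1 : (s3.set 50 (4 % 2 ^ b)).set 20 (s.mem 4 * (K * (r + 8)) + 4) = s4
    generalize k2 : den b S (.fetch 5 20) s4 = s5
    simp only [den] at k2
    have n4 : s5.mem 4 = s.mem 4 := by simp [← k2, ← k1, Store.mem_set, m4]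
    rw [den_affine (s := s5) (by decide) (by decide) (by rw [n4]; omega), n4]
    generalize k3 : (s5.set 50 (5 % 2 ^ b)).set 20 (s.mem 4 * (K * (r + 8)) + 5) = s6
    generalize k4 : den b S (.fetch 6 20) s6 = s7
    simp only [den] at k4
    have n4 : s7.mem 4 = s.mem 4 := by simp [← k4, ← k3, Store.mem_set, n4]
    rw [den_affine (by decide) (by decide) (by rw [n4]; omega), n4]
    refine ⟨?_, ?_, ?_, ?_, ?_, ?_, ?_⟩
    · simp [← k4, ← k3, ← k2, ← k1, a3.reg_zero]
    · simp [← k4, ← k3, ← k2, ← k1, a3.reg_one]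
    · simp [← k4, ← k3, ← k2, ← k1, a3.out]
    · intro a ha ha4 ha5 ha6
      have h20 : a ≠ 20 := by omega
      have h50 : a ≠ 50 := by omega
      simp only [← k4, ← k3, ← k2, ← k1, Store.mem_set, ha4, ha5, ha6, h20, h50, if_false]
      exact a3.mem a (by omega)
    · simp [Store.mem_set]
    · simp [← k4, ← k3, ← k2, ← k1, Store.mem_set, hS.word_start _ hN]
    · simp [← k4, ← k3, Store.mem_set, hS.word_pos _ hN]
  · simp only [hl, if_false, if_true, not_false_iff, false_and, false_or, true_and]
    refine ⟨a3.reg_zero, a3.reg_one, a3.out, ?_⟩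
    simp [Store.mem_set]

end

section

open Program

/-! ### The list of reported cycles -/

namespace Layout

open Classical in
/-- The cycles formed by path `p` with the paths `i, …, p - 1`, in a query with right
endpoint `x`. -/
noncomputable def innerList (D : Layout) (r : ℕ) (x : ℝ) (i p : ℕ) : List (List ℕ) :=
  ((List.Ico i p).filter fun i => Disjoint (D.interior r i) (D.interior r p) ∧ D.top i ≤ x).map
    (D.cycle r p)

open Classical in
/-- The cycles of the outer positions from `j` on, in the query `[x₁, x₂]`. -/
noncomputable def outerList (D : Layout) (r : ℕ) (x₁ x₂ : ℝ) (j : ℕ) : List (List ℕ) :=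
  ((List.Ico j D.Nout).filter fun j => D.need 0 j ≤ x₂ ∧ x₁ ≤ D.low j).flatMap
    fun j => D.innerList r x₂ (D.start j) (D.pos j)

variable {D : Layout} {K r : ℕ}

theorem filter_Ico_skip {ok : ℕ → Bool} {i f p : ℕ} (hif : i ≤ f) (hfp : f ≤ p)
    (h : ∀ k, i ≤ k → k < f → ¬ ok k) : (List.Ico i p).filter ok = (List.Ico f p).filter ok := by
  rw [← List.Ico.append_consecutive hif hfp, List.filter_append,
    List.filter_eq_nil_iff.2, List.nil_append]
  intro k hk
  rw [List.Ico.mem] at hk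
  exact h k hk.1 hk.2

theorem innerList_skip {x : ℝ} {i f p : ℕ} (hif : i ≤ f) (hfp : f ≤ p)
    (h : ∀ k, i ≤ k → k < f →
      ¬ (Disjoint (D.interior r k) (D.interior r p) ∧ D.top k ≤ x)) :
    D.innerList r x i p = D.innerList r x f p := by
  rw [innerList, filter_Ico_skip hif hfp (fun k h1 h2 => by simpa using h k h1 h2), innerList]

theorem innerList_self (x : ℝ) (p : ℕ) : D.innerList r x p p = [] := by simp [innerList]

theorem innerList_cons {x : ℝ} {i p : ℕ} (hi : i < p)
    (h : Disjoint (D.interior r i) (D.interior r p) ∧ D.top i ≤ x) :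
    D.innerList r x i p = D.cycle r p i :: D.innerList r x (i + 1) p := by
  rw [innerList, List.Ico.eq_cons hi, List.filter_cons_of_pos (by simpa using h), List.map_cons,
    innerList]

theorem outerList_skip {x₁ x₂ : ℝ} {j f : ℕ} (hjf : j ≤ f) (hf : f ≤ D.Nout)
    (h : ∀ k, j ≤ k → k < f → ¬ D.need 0 k ≤ x₂) :
    D.outerList r x₁ x₂ j = D.outerList r x₁ x₂ f := by
  rw [outerList, filter_Ico_skip hjf hf (fun k h1 h2 => by
    have := h k h1 h2; simp [this]), outerList]

theorem outerList_end (x₁ x₂ : ℝ) : D.outerList r x₁ x₂ D.Nout = [] := by simp [outerList]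

theorem outerList_cons {x₁ x₂ : ℝ} {j : ℕ} (hj : j < D.Nout) (h : D.need 0 j ≤ x₂)
    (h' : x₁ ≤ D.low j) : D.outerList r x₁ x₂ j =
      D.innerList r x₂ (D.start j) (D.pos j) ++ D.outerList r x₁ x₂ (j + 1) := by
  rw [outerList, List.Ico.eq_cons hj, List.filter_cons_of_pos (by simp [h, h']),
    List.flatMap_cons, outerList]

/-- Since `low` decreases along the outer positions, the first one below x₁ rules out all later
ones. -/
theorem Valid.outerList_eq_nil (hD : D.Valid K r) {x₁ x₂ : ℝ} {j : ℕ} (h : ¬ x₁ ≤ D.low j) :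
    D.outerList r x₁ x₂ j = [] := by
  rw [outerList, (List.filter_eq_nil_iff (l := List.Ico j D.Nout)).2, List.flatMap_nil]
  intro k hk
  rw [List.Ico.mem] at hk
  have := hD.low_anti j k hk.1 hk.2
  simp only [decide_eq_true_eq, not_and]
  intro _ h'
  exact h (h'.trans this)

/-- This is the source of the delay bound: the search for small `need` never stops at a path without
a cycle to report. -/
theorem Valid.innerList_ne_nil (hD : D.Valid K r) {x : ℝ} {j : ℕ} (hj : j < D.Nout)
    (h : D.need 0 j ≤ x) : D.innerList r x (D.start j) (D.pos j) ≠ [] := by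
  obtain ⟨i, h1, h2, h3, h4⟩ := hD.productive j hj
  apply List.ne_nil_of_mem (a := D.cycle r (D.pos j) i)
  rw [innerList, List.mem_map]
  exact ⟨i, List.mem_filter.2 ⟨List.Ico.mem.2 ⟨h1, h2⟩, by simpa using ⟨h3, h4.trans h⟩⟩, rfl⟩

/-- Before each round of the query `[x₁, x₂]`; `ws` are the cycles that remain to be reported. -/
structure RoundInv (D : Layout) (r : ℕ) (x₁ x₂ : ℝ) (ws : List (List ℕ)) (s : Store) : Prop where
  mem_zero : s.mem 0 = D.N
  mem_one : s.mem 1 = D.Nout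
  mem_two : s.mem 2 = 2 ^ D.levels / 2
  mem_three : s.mem 3 = (D.levels - 1) * D.N
  mem_seven : s.mem 7 = 1
  reg_zero : s.reg 0 = x₁
  reg_one : s.reg 1 = x₂
  outer_le : s.mem 4 ≤ D.Nout
  inner_le : s.mem 5 ≤ s.mem 6
  path_le : s.mem 6 ≤ D.N
  path_lt : s.mem 5 < s.mem 6 → s.mem 6 < D.N
  rest : ws = D.innerList r x₂ (s.mem 5) (s.mem 6) ++ D.outerList r x₁ x₂ (s.mem 4)

end Layout

open Layout

section
variable {b : ℕ} {S : DataStructure} {s : Store} {D : Layout} {K r : ℕ}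

theorem Program.loopFree_innerCheck (K r : ℕ) : (innerCheck K r).LoopFree := by
  have h1 : compareWord.LoopFree := by simp [compareWord, block, LoopFree, affine]
  have h2 : (searchWord r).LoopFree := by
    simp [searchWord, block, LoopFree, affine, h1.repeat]
  have h3 : (checkRecord r).LoopFree := by
    simp [checkRecord, block, LoopFree, affine, h2.repeat]
  simp [innerCheck, block, LoopFree, affine, h3.repeat]

theorem Program.loopFree_outerCheck (K : ℕ) : (outerCheck K).LoopFree := by
  simp [outerCheck, block, LoopFree, affine]

theorem Program.loopFree_emitCycle (K r : ℕ) : (emitCycle K r).LoopFree := by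
  have h1 : (block [emitWord, .affine 20 20 1 1]).LoopFree := by
    simp [emitWord, block, LoopFree, affine]
  have h2 : (block [emitWord, .const 50 1, .op .sub 20 20 50]).LoopFree := by
    simp [emitWord, block, LoopFree]
  exact ⟨loopFree_affine _ _ _ _, h1.repeat _, loopFree_affine _ _ _ _, h2.repeat _,
    loopFree_affine _ _ _ _⟩

theorem Program.loopFree_tryLoad (K r : ℕ) : (tryLoad K r).LoopFree := by
  simp [tryLoad, loadPath, block, LoopFree, affine]

theorem Layout.Stored.row_lt (hS : D.Stored K r b S) (hD : D.Valid K r) :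
    (D.levels - 1) * D.N < 2 ^ b := by
  refine lt_of_le_of_lt ?_ hS.bound
  rw [mul_assoc (D.levels * D.N)]
  exact (Nat.mul_le_mul_right _ (Nat.sub_le _ _)).trans
    (Nat.le_mul_of_pos_right _ (Nat.mul_pos hD.K_pos (by omega)))

/-- The running time of a round on a table with `L` levels. -/
def Program.roundTime (K r L : ℕ) : ℕ :=
  findNextTime (innerCheck K r) 5 6 L + findNextTime (outerCheck K) 4 1 L + (emitCycle K r).cost +
    (tryLoad K r).cost + 20

/-- Advancing the inner pointer skips only paths that form no cycle in range with the current one,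
so the list of pending cycles does not change. -/
theorem Layout.RoundInv.eval_inner (hS : D.Stored K r b S) (hD : D.Valid K r) {x₁ x₂ : ℝ}
    {ws : List (List ℕ)} (h : D.RoundInv r x₁ x₂ ws s) :
    ∃ s', Eval b S (.seq (findNext (innerCheck K r) 5 6) (.op .lt 14 5 6))
        (findNextTime (innerCheck K r) 5 6 D.levels + 2) s s' ∧
      D.RoundInv r x₁ x₂ ws s' ∧ s'.out = s.out ∧
      D.innerList r x₂ (s'.mem 5) (s'.mem 6) = D.innerList r x₂ (s.mem 5) (s.mem 6) ∧
      ((s'.mem 14 = 0 ∧ s'.mem 5 = s'.mem 6) ∨ (s'.mem 14 = 1 ∧ s'.mem 5 < s'.mem 6 ∧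
        Disjoint (D.interior r (s'.mem 5)) (D.interior r (s'.mem 6)) ∧ D.top (s'.mem 5) ≤ x₂)) := by
  have hb := hS.bound'
  obtain ⟨s₁, ev, a1, le1, le2, hno, hok⟩ := eval_findNext (b := b) (S := S) (s := s) (N := D.N)
    (L := D.levels) (d := 5) (e := 6)
    (ok := fun i => Disjoint (D.interior r i) (D.interior r (s.mem 6)) ∧ D.top i ≤ x₂)
    (loopFree_innerCheck K r) (by decide) (by decide) (by decide) (by decide) (by omega) (by omega)
    (hS.row_lt hD) rfl h.mem_zero h.mem_two h.mem_three h.inner_le h.path_le (by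
      intro s' m hs' hm hrow hge hle
      have h6 := hs'.mem 6 (by decide) (by decide)
      have h2m : 0 < 2 ^ m := by positivity
      have := den_innerCheck hS hD hm (by rw [h6]; exact hle)
        (by
          rw [h6]
          exact h.path_lt (by omega)) hrow
      rwa [h6, hs'.reg_one, h.reg_one] at this)
  have m6 := a1.mem 6 (by decide) (by decide)
  refine ⟨(op .lt 14 5 6).den b S s₁, (ev.seq (LoopFree.eval (p := op .lt 14 5 6) trivial s₁)).mono
    (by simp [cost]),
    ?_, ?_, ?_, ?_⟩
  · have hm : ∀ a < 10, ((op .lt 14 5 6).den b S s₁).mem a = s₁.mem a := by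
      intro a ha
      simp only [den, Store.mem_set]
      rw [if_neg (by omega)]
    have hm' : ∀ a < 10, a ≠ 5 → ((op .lt 14 5 6).den b S s₁).mem a = s.mem a :=
      fun a ha h5 => (hm a ha).trans (a1.mem a ha h5)
    constructor
    · rw [hm' _ (by decide) (by decide), h.mem_zero]
    · rw [hm' _ (by decide) (by decide), h.mem_one]
    · rw [hm' _ (by decide) (by decide), h.mem_two]
    · rw [hm' _ (by decide) (by decide), h.mem_three]
    · rw [hm' _ (by decide) (by decide), h.mem_seven]
    · exact a1.reg_zero.trans h.reg_zero
    · exact a1.reg_one.trans h.reg_one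
    · rw [hm' _ (by decide) (by decide)]; exact h.outer_le
    · rw [hm _ (by decide), hm' _ (by decide) (by decide)]; exact le2
    · rw [hm' _ (by decide) (by decide)]; exact h.path_le
    · rw [hm _ (by decide), hm' _ (by decide) (by decide)]
      exact fun h' => h.path_lt (by omega)
    · rw [hm _ (by decide), hm' _ (by decide) (by decide), hm' _ (by decide) (by decide), h.rest,
        innerList_skip le1 le2 hno]
  · exact a1.out
  · have m5' : ((op .lt 14 5 6).den b S s₁).mem 5 = s₁.mem 5 := by simp [den, Store.mem_set]
    have m6' : ((op .lt 14 5 6).den b S s₁).mem 6 = s₁.mem 6 := by simp [den, Store.mem_set]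
    rw [m5', m6', m6, ← innerList_skip le1 le2 hno]
  · have m5' : ((op .lt 14 5 6).den b S s₁).mem 5 = s₁.mem 5 := by simp [den, Store.mem_set]
    have m6' : ((op .lt 14 5 6).den b S s₁).mem 6 = s.mem 6 := by simp [den, Store.mem_set, m6]
    have m14 : ((op .lt 14 5 6).den b S s₁).mem 14 = if s₁.mem 5 < s.mem 6 then 1 else 0 := by
      simp [den, Store.mem_set, m6, WordOp.value]
    rw [m5', m6', m14]
    rcases lt_or_eq_of_le le2 with h' | h'
    · exact .inr ⟨by simp [h'], h', hok h'⟩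
    · exact .inl ⟨by simp [h'], h'⟩

end

end

/-! ### Rounds of the query and the delay -/

section

open Program Layout

section
variable {b : ℕ} {S : DataStructure} {s : Store} {D : Layout} {K r : ℕ}

/-- A round that finds no further cycle with the current path. -/
theorem Layout.RoundInv.eval_outer (hS : D.Stored K r b S) (hD : D.Valid K r) {x₁ x₂ : ℝ}
    {ws : List (List ℕ)} (h : D.RoundInv r x₁ x₂ ws s) (h56 : s.mem 5 = s.mem 6) :
    ∃ s', Eval b S (.seq (findNext (outerCheck K) 4 1) (.seq (.op .lt 14 4 1)
        (.ite 14 (tryLoad K r) (.const 7 0))))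
        (findNextTime (outerCheck K) 4 1 D.levels + (tryLoad K r).cost + 10) s s' ∧
      s'.out = s.out ∧ ((D.RoundInv r x₁ x₂ ws s' ∧
        D.innerList r x₂ (s'.mem 5) (s'.mem 6) ≠ []) ∨ (ws = [] ∧ s'.mem 7 = 0)) := by
  have hb := hS.bound'
  have hinner : D.innerList r x₂ (s.mem 5) (s.mem 6) = [] := by rw [h56, innerList_self]
  obtain ⟨s₁, ev, a1, le1, le2, hno, hok⟩ := eval_findNext (b := b) (S := S) (s := s) (N := D.N)
    (L := D.levels) (d := 4) (e := 1) (ok := fun i => D.need 0 i ≤ x₂)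
    (loopFree_outerCheck K) (by decide) (by decide) (by decide) (by decide) (by omega) (by omega)
    (hS.row_lt hD) rfl h.mem_zero h.mem_two h.mem_three (by rw [h.mem_one]; exact h.outer_le)
    (by rw [h.mem_one]; exact hD.Nout_le) (by
      intro s' m hs' hm hrow _ hle
      have := den_outerCheck hS hD hm (by rw [← h.mem_one]; exact hle) hrow
      rwa [hs'.reg_one, h.reg_one] at this)
  rw [h.mem_one] at le2 hok
  have m1 := (a1.mem 1 (by decide) (by decide)).trans h.mem_one
  generalize e2 : (op .lt 14 4 1).den b S s₁ = s₂
  have ev2 : Eval b S (op .lt 14 4 1) 1 s₁ s₂ := e2 ▸ LoopFree.eval (p := op .lt 14 4 1) trivial s₁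
  simp only [den, WordOp.value, m1] at e2
  have f2 : ∀ a < 10, s₂.mem a = s₁.mem a := by
    intro a ha
    rw [← e2, Store.mem_set, if_neg (by omega)]
  have f2' : ∀ a < 10, a ≠ 4 → s₂.mem a = s.mem a :=
    fun a ha h4 => (f2 a ha).trans (a1.mem a ha h4)
  have r20 : s₂.reg 0 = x₁ := by rw [← e2]; exact a1.reg_zero.trans h.reg_zero
  have r21 : s₂.reg 1 = x₂ := by rw [← e2]; exact a1.reg_one.trans h.reg_one
  have o2 : s₂.out = s.out := by rw [← e2]; exact a1.out
  have m4 := f2 4 (by decide)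
  have m14 : s₂.mem 14 = if s₁.mem 4 < D.Nout then 1 else 0 := by simp [← e2, Store.mem_set]
  have hws : ws = D.outerList r x₁ x₂ (s₁.mem 4) := by
    rw [h.rest, hinner, List.nil_append, outerList_skip le1 le2 hno]
  rw [← m4] at le2 hok m14 hws
  rcases lt_or_eq_of_le le2 with hlt | heq
  · obtain ⟨q1, q2, q3, q4⟩ := den_tryLoad hS hD hlt
    refine ⟨_, (ev.seq (ev2.seq (Eval.ite_pos (by simp [m14, hlt])
      (LoopFree.eval (loopFree_tryLoad K r) s₂)))).mono (by omega), q3.trans o2, ?_⟩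
    generalize (tryLoad K r).den b S s₂ = s₃ at *
    rw [r20] at q4
    rcases q4 with ⟨hl, f3, n4, n5, n6⟩ | ⟨hl, h7⟩
    · left
      refine ⟨⟨?_, ?_, ?_, ?_, ?_, q1.trans r20, q2.trans r21, ?_, ?_, ?_, ?_, ?_⟩, ?_⟩
      · rw [f3 _ (by decide) (by decide) (by decide) (by decide), f2' _ (by decide) (by decide),
          h.mem_zero]
      · rw [f3 _ (by decide) (by decide) (by decide) (by decide), f2' _ (by decide) (by decide),
          h.mem_one]
      · rw [f3 _ (by decide) (by decide) (by decide) (by decide), f2' _ (by decide) (by decide),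
          h.mem_two]
      · rw [f3 _ (by decide) (by decide) (by decide) (by decide), f2' _ (by decide) (by decide),
          h.mem_three]
      · rw [f3 _ (by decide) (by decide) (by decide) (by decide), f2' _ (by decide) (by decide),
          h.mem_seven]
      · rw [n4]; exact hlt
      · rw [n5, n6]; exact hD.start_le _ hlt
      · rw [n6]; exact (hD.pos_lt _ hlt).le
      · rw [n6]; exact fun _ => hD.pos_lt _ hlt
      · rw [n4, n5, n6, hws, outerList_cons hlt (hok hlt) hl]
      · rw [n5, n6]; exact hD.innerList_ne_nil hlt (hok hlt)
    · exact .inr ⟨by rw [hws, hD.outerList_eq_nil hl], h7⟩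
  · refine ⟨_, (ev.seq (ev2.seq (Eval.ite_neg (by simp [m14, heq])
      (LoopFree.eval (p := const 7 0) trivial s₂)))).mono (by simp [cost]; omega), o2, .inr ⟨?_, ?_⟩⟩
    · rw [hws, heq, outerList_end]
    · simp [den, Store.mem_set]

/-- A round of the query. -/
theorem Layout.RoundInv.eval_round (hS : D.Stored K r b S) (hD : D.Valid K r) {x₁ x₂ : ℝ}
    {ws : List (List ℕ)} (h : D.RoundInv r x₁ x₂ ws s) :
    ∃ s', Eval b S (Program.round K r) (roundTime K r D.levels) s s' ∧
      ((∃ w ws', ws = w :: ws' ∧ w.length = 2 * (r + 1) ∧ s'.out = s.out ++ w ∧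
          D.RoundInv r x₁ x₂ ws' s') ∨
        (D.innerList r x₂ (s.mem 5) (s.mem 6) = [] ∧ s'.out = s.out ∧
          ((D.RoundInv r x₁ x₂ ws s' ∧ D.innerList r x₂ (s'.mem 5) (s'.mem 6) ≠ []) ∨
            (ws = [] ∧ s'.mem 7 = 0)))) := by
  obtain ⟨s₁, ev, h1, o1, i1, hcase⟩ := h.eval_inner hS hD
  have main : ∀ p T s', Eval b S p T s₁ s' → T ≤ findNextTime (outerCheck K) 4 1 D.levels +
      (emitCycle K r).cost + (tryLoad K r).cost + 14 →
      (s₁.mem 14 ≠ 0 ∧ p = emitCycle K r ∨ s₁.mem 14 = 0 ∧ p = (.seq (findNext (outerCheck K) 4 1)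
        (.seq (.op .lt 14 4 1) (.ite 14 (tryLoad K r) (.const 7 0))))) →
      Eval b S (Program.round K r) (roundTime K r D.levels) s s' := by
    rintro p T s' ev' hT hp
    have ev'' : Eval b S (.ite 14 (emitCycle K r) (.seq (findNext (outerCheck K) 4 1)
        (.seq (.op .lt 14 4 1) (.ite 14 (tryLoad K r) (.const 7 0))))) (T + 1) s₁ s' := by
      rcases hp with ⟨h14, rfl⟩ | ⟨h14, rfl⟩
      exacts [ev'.ite_pos h14, ev'.ite_neg h14]
    exact (ev.seq ev'').mono (by unfold roundTime; omega)
  rcases hcase with ⟨h14, h56⟩ | ⟨h14, h56, hdis, htop⟩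
  · obtain ⟨s₂, ev2, o2, hc⟩ := h1.eval_outer hS hD h56
    refine ⟨s₂, main _ _ _ ev2 (by omega) (.inr ⟨h14, rfl⟩), .inr ⟨?_, o2.trans o1, hc⟩⟩
    rw [← i1, h56, innerList_self]
  · have h6 := h1.path_lt h56
    obtain ⟨f2, m5, r2, o2⟩ := den_emitCycle hS hD (h56.trans h6) h6
    refine ⟨_, main _ _ _ (LoopFree.eval (loopFree_emitCycle K r) s₁) (by omega)
      (.inl ⟨by simp [h14], rfl⟩), .inl ⟨D.cycle r (s₁.mem 6) (s₁.mem 5),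
      D.innerList r x₂ (s₁.mem 5 + 1) (s₁.mem 6) ++ D.outerList r x₁ x₂ (s₁.mem 4), ?_,
      D.length_cycle _ _ _, by rw [o2, o1], ?_⟩⟩
    · rw [h1.rest, innerList_cons h56 ⟨hdis, htop⟩, List.cons_append]
    · constructor
      · rw [f2 _ (by decide) (by decide), h1.mem_zero]
      · rw [f2 _ (by decide) (by decide), h1.mem_one]
      · rw [f2 _ (by decide) (by decide), h1.mem_two]
      · rw [f2 _ (by decide) (by decide), h1.mem_three]
      · rw [f2 _ (by decide) (by decide), h1.mem_seven]
      · rw [r2, h1.reg_zero]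
      · rw [r2, h1.reg_one]
      · rw [f2 _ (by decide) (by decide)]; exact h1.outer_le
      · rw [f2 6 (by decide) (by decide), m5]; exact h56
      · rw [f2 _ (by decide) (by decide)]; exact h6.le
      · rw [f2 6 (by decide) (by decide)]; exact fun _ => h6
      · rw [f2 6 (by decide) (by decide), m5, f2 4 (by decide) (by decide)]

theorem Eval.loop_iterate {p : Program} {s' : Store} {T x : ℕ} (hx : s.mem x ≠ 0)
    (h : Eval b S p T s s') : ∃ t ≤ T + 1,
      (Config.step b S)^[t] (s.config [.loop x p]) = s'.config [.loop x p] := by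
  obtain ⟨t, ht, h⟩ := h
  refine ⟨t + 1, by omega, ?_⟩
  rw [Function.iterate_succ_apply]
  have : Config.step b S (s.config [.loop x p]) = s.config [p, .loop x p] := by
    simp [Config.step, Store.config, hx]
  rw [this, h]

/-- The delay of the query on a table with `L` levels. -/
def Program.queryDelay (K r L : ℕ) : ℕ := 2 * (40 + 2 * (roundTime K r L + 2))

/-- The query lists the cycles of the structure with a bounded delay. -/
theorem Layout.Stored.query_spec (hS : D.Stored K r b S) (hD : D.Valid K r) (x₁ x₂ : ℝ) :
    (∃ T, (queryRun b S (query K r) x₁ x₂ T).Halted ∧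
      (queryRun b S (query K r) x₁ x₂ T).out = (D.outerList r x₁ x₂ 0).flatten) ∧
    ∀ t, (queryRun b S (query K r) x₁ x₂ (t + queryDelay K r D.levels)).Halted ∨
      (queryRun b S (query K r) x₁ x₂ t).out.length / (2 * (r + 1)) <
        (queryRun b S (query K r) x₁ x₂ (t + queryDelay K r D.levels)).out.length /
          (2 * (r + 1)) := by
  set R := roundTime K r D.levels with hR
  -- The slack of 40 steps absorbs the setup, so the initial configuration satisfies the same
  -- invariant as the configuration after a report, where the slack is 0.
  set I : List (List ℕ) → Config → Prop := fun ws c => ∃ t ≤ 40, ∃ s : Store,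
    (Config.step b S)^[t] c = s.config [.loop 7 (Program.round K r)] ∧ D.RoundInv r x₁ x₂ ws s ∧
      s.out = c.out with hI
  have round : ∀ ws s, D.RoundInv r x₁ x₂ ws s → ∃ t ≤ R + 1, ∃ s' : Store,
      (Config.step b S)^[t] (s.config [.loop 7 (Program.round K r)]) =
        s'.config [.loop 7 (Program.round K r)] ∧
      ((∃ w ws', ws = w :: ws' ∧ w.length = 2 * (r + 1) ∧ s'.out = s.out ++ w ∧
          D.RoundInv r x₁ x₂ ws' s') ∨
        (D.innerList r x₂ (s.mem 5) (s.mem 6) = [] ∧ s'.out = s.out ∧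
          ((D.RoundInv r x₁ x₂ ws s' ∧ D.innerList r x₂ (s'.mem 5) (s'.mem 6) ≠ []) ∨
            (ws = [] ∧ s'.mem 7 = 0)))) := by
    intro ws s h
    obtain ⟨s', ev, h'⟩ := h.eval_round hS hD
    obtain ⟨t, ht, e⟩ := Eval.loop_iterate (x := 7) (by rw [h.mem_seven]; decide) ev
    exact ⟨t, ht, s', e, h'⟩
  have hinit : I (D.outerList r x₁ x₂ 0) (Config.init (query K r) x₁ x₂) := by
    set s₀ : Store := ⟨fun _ => 0, fun r => if r = 0 then x₁ else if r = 1 then x₂ else 0, []⟩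
      with hs₀
    have hb := hS.bound'
    obtain ⟨t, ht, ev⟩ := LoopFree.eval (b := b) (S := S) (p := setup)
      (by simp [setup, block, LoopFree]) s₀
    refine ⟨t + 1, by simp [setup, block, cost] at ht; omega, setup.den b S s₀, ?_, ?_, ?_⟩
    · rw [Function.iterate_succ_apply]
      exact ev _
    · have e1 : 1 % 2 ^ b = 1 := Nat.mod_eq_of_lt (by omega)
      have e2 : 2 % 2 ^ b = 2 := Nat.mod_eq_of_lt (by omega)
      have e3 : 3 % 2 ^ b = 3 := Nat.mod_eq_of_lt (by omega)
      constructor <;> simp [setup, block, den, Store.mem_set, e1, e2, e3, hS.word_zero,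
        hS.word_one, hS.word_two, hS.word_three, s₀, innerList_self]
    · rfl
  obtain ⟨h1, h2⟩ := delay_of_blocks (b := b) (S := S) (k := 2 * (r + 1))
    (D := 40 + 2 * (R + 2)) (by omega) I (by
      rintro w ws c ⟨t, ht, s, hs, hinv, ho⟩
      obtain ⟨t₁, ht₁, s₁, e₁, h₁⟩ := round _ _ hinv
      rcases h₁ with ⟨w', ws', e, hw, ho', hinv'⟩ | ⟨-, ho', ⟨hinv', hne⟩ | ⟨e, -⟩⟩
      · rw [List.cons.injEq] at e
        obtain ⟨rfl, rfl⟩ := e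
        have e : (Config.step b S)^[t₁ + t] c = s₁.config [.loop 7 (Program.round K r)] := by
          rw [Function.iterate_add_apply, hs, e₁]
        refine ⟨hw, t₁ + t, by omega, ⟨0, by omega, s₁, e, hinv', ?_⟩, ?_⟩
        · rw [e]; rfl
        · rw [e]; exact ho'.trans (by rw [ho])
      -- The first round only loaded a new path. Its inner list is nonempty, so the second round
      -- must report a cycle.
      · obtain ⟨t₂, ht₂, s₂, e₂, h₂⟩ := round _ _ hinv'
        rcases h₂ with ⟨w', ws', e, hw, ho'', hinv''⟩ | ⟨hne', -⟩
        · rw [List.cons.injEq] at e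
          obtain ⟨rfl, rfl⟩ := e
          have e : (Config.step b S)^[t₂ + (t₁ + t)] c =
              s₂.config [.loop 7 (Program.round K r)] := by
            rw [Function.iterate_add_apply, Function.iterate_add_apply, hs, e₁, e₂]
          refine ⟨hw, t₂ + (t₁ + t), by omega, ⟨0, by omega, s₂, e, hinv'', ?_⟩, ?_⟩
          · rw [e]; rfl
          · rw [e]; exact ho''.trans (by rw [ho', ho])
        · exact absurd hne' hne
      · exact absurd e (by simp)) (by
      rintro c ⟨t, ht, s, hs, hinv, ho⟩
      obtain ⟨t₁, ht₁, s₁, e₁, h₁⟩ := round _ _ hinv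
      rcases h₁ with ⟨w', ws', e, -⟩ | ⟨-, ho', ⟨hinv', hne⟩ | ⟨-, h7⟩⟩
      · exact absurd e (by simp)
      -- With nothing left to report, no path with a nonempty inner list can have been loaded.
      · exact absurd (List.append_eq_nil_iff.1 hinv'.rest.symm).1 hne
      · have e : (Config.step b S)^[1 + (t₁ + t)] c = s₁.config [] := by
          rw [Function.iterate_add_apply, Function.iterate_add_apply, hs, e₁]
          simp [Config.step, Store.config, h7]
        refine ⟨1 + (t₁ + t), by omega, by rw [e]; rfl, ?_⟩
        rw [e]; exact ho'.trans ho) _ _ hinit 0 rfl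
  exact ⟨h1, h2⟩

end

end

/-! ### Encoding a layout in memory -/

namespace Layout

/-- The contents of word number `o` of the record of block `(m, j)` and slot `s`. -/
def field (D : Layout) (m j s : ℕ) : ℕ → ℕ
  | 0 => D.N
  | 1 => D.Nout
  | 2 => 2 ^ D.levels / 2
  | 3 => (D.levels - 1) * D.N
  | 4 => D.start j
  | 5 => D.pos j
  | t + 6 => D.vert (D.rep m j s) t

/-- The contents of real number `o` of the record of block `(m, j)` and slot `s`. -/
noncomputable def realField (D : Layout) (m j s : ℕ) : ℕ → ℝ
  | 0 => D.low j
  | 1 => D.need m j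
  | _ => D.top (D.rep m j s)

/-- The number of records. -/
def size (D : Layout) (K : ℕ) : ℕ := D.levels * D.N * K

/-- The data structure: a table with one record for each block and slot. -/
noncomputable def dataStructure (D : Layout) (K r : ℕ) : DataStructure where
  words := (List.range (D.size K * (r + 8))).map fun a =>
    D.field (a / (r + 8) / K / D.N) (a / (r + 8) / K % D.N) (a / (r + 8) % K) (a % (r + 8))
  reals := (List.range (D.size K * 3)).map fun a =>
    D.realField (a / 3 / K / D.N) (a / 3 / K % D.N) (a / 3 % K) (a % 3)

variable {D : Layout} {K r b : ℕ}

theorem space_dataStructure : (D.dataStructure K r).space = D.size K * (r + 11) := by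
  simp [DataStructure.space, dataStructure]; ring

theorem getD_map_range {α : Type*} (f : ℕ → α) {n a : ℕ} (d : α) (h : a < n) :
    ((List.range n).map f).getD a d = f a := by
  simp [List.getD, h]

theorem decode {N x y : ℕ} (hy : y < N) : (x * N + y) / N = x ∧ (x * N + y) % N = y := by
  have hN : 0 < N := by omega
  constructor
  · rw [add_comm, Nat.add_mul_div_right _ _ hN, Nat.div_eq_of_lt hy, zero_add]
  · rw [add_comm, Nat.add_mul_mod_self_right, Nat.mod_eq_of_lt hy]

theorem word_dataStructure {m j s o : ℕ} (hm : m < D.levels) (hj : j < D.N) (hs : s < K)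
    (ho : o < r + 8) :
    (D.dataStructure K r).word (((m * D.N + j) * K + s) * (r + 8) + o) = D.field m j s o := by
  have h := record_lt hm hj hs
  have h' : ((m * D.N + j) * K + s) * (r + 8) + o < D.size K * (r + 8) :=
    lt_of_lt_of_le (Nat.add_lt_add_left ho _)
      (by rw [← add_one_mul]; exact Nat.mul_le_mul_right _ h)
  rw [DataStructure.word, dataStructure, getD_map_range _ _ h', (decode ho).1, (decode ho).2,
    (decode hs).1, (decode hs).2, (decode hj).1, (decode hj).2]

theorem real_dataStructure {m j s o : ℕ} (hm : m < D.levels) (hj : j < D.N) (hs : s < K)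
    (ho : o < 3) :
    (D.dataStructure K r).real (((m * D.N + j) * K + s) * 3 + o) = D.realField m j s o := by
  have h := record_lt hm hj hs
  have h' : ((m * D.N + j) * K + s) * 3 + o < D.size K * 3 := by
    have : ((m * D.N + j) * K + s) < D.size K := h
    omega
  rw [DataStructure.real, dataStructure, getD_map_range _ _ h', (decode ho).1, (decode ho).2,
    (decode hs).1, (decode hs).2, (decode hj).1, (decode hj).2]

theorem Valid.stored (hD : D.Valid K r) (hb : D.size K * (r + 8) < 2 ^ b)
    (hb' : 2 * D.N + 8 < 2 ^ b) : D.Stored K r b (D.dataStructure K r) := by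
  have hK := hD.K_pos
  have header : ∀ o < r + 8, 0 < D.N → (D.dataStructure K r).word o = D.field 0 0 0 o := by
    intro o ho hN
    have := word_dataStructure (r := r) (o := o) (levels_pos hN) hN hK ho
    simpa using this
  -- Without paths the table is empty and holds no header. Reads outside the arrays return 0, which
  -- is then the correct value of all four parameters.
  have empty : D.N = 0 → ∀ o, (D.dataStructure K r).word o = 0 := by
    intro hN o
    simp [DataStructure.word, dataStructure, size, hN]
  have hlev : D.N = 0 → D.levels = 0 := by intro hN; simp [levels, hN]
  constructor
  · exact hb
  · exact hb'
  · rcases Nat.eq_zero_or_pos D.N with hN | hN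
    · rw [empty hN, hN]
    · exact header 0 (by omega) hN
  · rcases Nat.eq_zero_or_pos D.N with hN | hN
    · have := hD.Nout_le
      rw [empty hN]; omega
    · exact header 1 (by omega) hN
  · rcases Nat.eq_zero_or_pos D.N with hN | hN
    · rw [empty hN, hlev hN]; rfl
    · exact header 2 (by omega) hN
  · rcases Nat.eq_zero_or_pos D.N with hN | hN
    · rw [empty hN, hN, mul_zero]
    · exact header 3 (by omega) hN
  · intro j hj
    have := word_dataStructure (r := r) (o := 4) (levels_pos (by omega)) hj hK (by omega)
    rw [← show D.field 0 j 0 4 = D.start j from rfl, ← this]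
    congr 1; ring
  · intro j hj
    have := word_dataStructure (r := r) (o := 5) (levels_pos (by omega)) hj hK (by omega)
    rw [← show D.field 0 j 0 5 = D.pos j from rfl, ← this]
    congr 1; ring
  · intro m j s t hm hj hs ht
    rw [word_dataStructure hm hj hs (by omega), add_comm 6 t]
    rfl
  · intro j hj
    have := real_dataStructure (r := r) (o := 0) (levels_pos (by omega)) hj hK (by omega)
    rw [← show D.realField 0 j 0 0 = D.low j from rfl, ← this]
    congr 1; ring
  · intro m j hm hj
    have := real_dataStructure (r := r) (o := 1) hm hj hK (by omega)
    rw [← show D.realField m j 0 1 = D.need m j from rfl, ← this]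
    congr 1; ring
  · intro m j s hm hj hs
    exact real_dataStructure hm hj hs (by omega)

theorem lt_of_mem_words (h1 : 2 ^ D.levels < 2 ^ b) (h2 : D.levels * D.N < 2 ^ b)
    (hN : D.N < 2 ^ b) (h3 : D.Nout ≤ D.N) (h4 : ∀ j, D.start j ≤ D.N) (h5 : ∀ j, D.pos j ≤ D.N)
    (h6 : ∀ i t, D.vert i t < 2 ^ b) : ∀ w ∈ (D.dataStructure K r).words, w < 2 ^ b := by
  intro w hw
  simp only [dataStructure, List.mem_map] at hw
  obtain ⟨a, -, rfl⟩ := hw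
  unfold field
  split
  · exact hN
  · exact h3.trans_lt hN
  · exact (Nat.div_le_self _ _).trans_lt h1
  · exact (Nat.mul_le_mul_right _ (Nat.sub_le _ _)).trans_lt h2
  · exact (h4 _).trans_lt hN
  · exact (h5 _).trans_lt hN
  · exact h6 _ _

end Layout

/-! ### Weighted representatives -/

/-- The size of a representative family of `r`-sets with respect to `s`-sets. -/
def representativeBound (r : ℕ) : ℕ → ℕ
  | 0 => 1
  | s + 1 => 1 + r * representativeBound r s

/-- Take a set A a of least weight. If it avoids B, it serves. Otherwise B contains one of its at
most r elements, say x; any set avoiding B lies in the subfamily of sets avoiding x, and there only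
B without x still has to be avoided. Recursion on the size of B, with one branch for each x in A a,
gives the bound 1 + r * (previous bound). -/
theorem exists_representatives {ι α : Type*} [DecidableEq ι] [DecidableEq α] (A : ι → Finset α)
    (w : ι → ℝ) {r : ℕ} (hA : ∀ i, (A i).card ≤ r) (s : ℕ) (F : Finset ι) :
    ∃ F' ⊆ F, F'.card ≤ representativeBound r s ∧ ∀ B : Finset α, B.card ≤ s → ∀ i ∈ F,
      Disjoint (A i) B → ∃ i' ∈ F', Disjoint (A i') B ∧ w i' ≤ w i := by
  induction s generalizing F with
  | zero =>
    rcases F.eq_empty_or_nonempty with rfl | hF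
    · exact ⟨∅, le_rfl, by simp, by simp⟩
    obtain ⟨a, ha, hmin⟩ := F.exists_min_image w hF
    refine ⟨{a}, by simpa using ha, by simp [representativeBound], fun B hB i hi _ => ?_⟩
    rw [Nat.le_zero, Finset.card_eq_zero] at hB
    exact ⟨a, by simp, by simp [hB], hmin i hi⟩
  | succ s ih =>
    rcases F.eq_empty_or_nonempty with rfl | hF
    · exact ⟨∅, le_rfl, by simp, by simp⟩
    obtain ⟨a, ha, hmin⟩ := F.exists_min_image w hF
    choose G hG1 hG2 hG3 using fun x : α => ih (F.filter fun i => x ∉ A i)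
    refine ⟨{a} ∪ (A a).biUnion G, ?_, ?_, fun B hB i hi hd => ?_⟩
    · refine Finset.union_subset (by simpa using ha) (Finset.biUnion_subset.2 fun x _ => ?_)
      exact (hG1 x).trans (Finset.filter_subset _ _)
    · refine (Finset.card_union_le _ _).trans ?_
      rw [Finset.card_singleton, representativeBound]
      refine Nat.add_le_add_left (Finset.card_biUnion_le.trans ?_) _
      refine (Finset.sum_le_card_nsmul _ _ _ fun x _ => hG2 x).trans ?_
      exact Nat.mul_le_mul_right _ (hA a)
    by_cases h : Disjoint (A a) B
    · exact ⟨a, by simp, h, hmin i hi⟩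
    obtain ⟨x, hxa, hxB⟩ := Finset.not_disjoint_iff.1 h
    have hxi : x ∉ A i := fun hx => Finset.disjoint_left.1 hd hx hxB
    obtain ⟨i', h1, h2, h3⟩ := hG3 x (B.erase x)
      (by rw [Finset.card_erase_of_mem hxB]; omega) i (Finset.mem_filter.2 ⟨hi, hxi⟩)
      (hd.mono_right (Finset.erase_subset _ _))
    refine ⟨i', Finset.mem_union_right _ (Finset.mem_biUnion.2 ⟨x, hxa, h1⟩), ?_, h3⟩
    have hxi' := (Finset.mem_filter.1 (hG1 x h1)).2
    rw [Finset.disjoint_left] at h2 ⊢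
    intro y hy hyB
    exact h2 hy (Finset.mem_erase.2 ⟨fun e => hxi' (e ▸ hy), hyB⟩)

/-- Representatives in an interval of indices, as a sequence of bounded length. -/
theorem exists_representative_seq {α : Type*} [DecidableEq α] (A : ℕ → Finset α) (w : ℕ → ℝ)
    {r : ℕ} (hA : ∀ i, (A i).card ≤ r) (s j k : ℕ) (hk : 0 < k) :
    ∃ f : ℕ → ℕ, (∀ u, j ≤ f u ∧ f u < j + k) ∧ ∀ B : Finset α, B.card ≤ s → ∀ i, j ≤ i →
      i < j + k → Disjoint (A i) B →
        ∃ u < representativeBound r s, Disjoint (A (f u)) B ∧ w (f u) ≤ w i := by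
  obtain ⟨F, h1, h2, h3⟩ := exists_representatives A w hA s (Finset.Ico j (j + k))
  have hmem : ∀ i ∈ F, j ≤ i ∧ i < j + k := fun i hi => Finset.mem_Ico.1 (h1 hi)
  -- Unused slots are filled with `j`, which belongs to the interval because `k` is positive.
  refine ⟨fun u => F.toList.getD u j, fun u => ?_, fun B hB i hi hi' hd => ?_⟩
  · by_cases hu : u < F.toList.length
    · simp only [List.getD_eq_getElem _ _ hu]
      exact hmem _ (Finset.mem_toList.1 (List.getElem_mem hu))
    · simp only [List.getD_eq_default _ _ (not_lt.1 hu)]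
      omega
  · obtain ⟨i', hi', h4⟩ := h3 B hB i (Finset.mem_Ico.2 ⟨hi, hi'⟩) hd
    obtain ⟨u, hu, e⟩ := List.getElem_of_mem (Finset.mem_toList.2 hi')
    refine ⟨u, lt_of_lt_of_le hu ?_, ?_⟩
    · rwa [Finset.length_toList]
    · simp only [List.getD_eq_getElem _ _ hu, e]; exact h4

/-! ### The layout of a family of paths -/

/-- For paths `0, …, N - 1` with vertices `vert`, largest attributes `top`, smallest attributes `low`,
and candidate partners `gs p, …, p - 1` of path `p`, there is a layout by which a query reports all
pairs of partners in range. -/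
theorem exists_layout (r N : ℕ) (vert : ℕ → ℕ → ℕ) (top low : ℕ → ℝ) (gs : ℕ → ℕ)
    (hgs : ∀ p, gs p ≤ p) :
    ∃ D : Layout, D.Valid (representativeBound r r) r ∧ D.N = N ∧ D.vert = vert ∧
      (∀ j, D.start j ≤ N) ∧ (∀ j, D.pos j ≤ N) ∧ ∀ x₁ x₂ : ℝ, ∃ pairs : List (ℕ × ℕ),
        pairs.Nodup ∧ D.outerList r x₁ x₂ 0 = pairs.map (fun q => D.cycle r q.1 q.2) ∧
        ∀ p i, (p, i) ∈ pairs ↔ p < N ∧ gs p ≤ i ∧ i < p ∧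
          Disjoint (D.interior r i) (D.interior r p) ∧ top i ≤ x₂ ∧ top p ≤ x₂ ∧ x₁ ≤ low p := by
  classical
  set int : ℕ → Finset ℕ := fun i => (Finset.range r).image fun t => vert i (t + 1) with hint
  have hcard : ∀ i, (int i).card ≤ r := fun i =>
    Finset.card_image_le.trans (Finset.card_range r).le
  choose f hf1 hf2 using fun m j : ℕ =>
    exists_representative_seq int top hcard r j (2 ^ m) (by positivity)
  set partners : ℕ → Finset ℕ := fun p =>
    (Finset.Ico (gs p) p).filter fun i => Disjoint (int i) (int p) with hpartners
  -- The least right endpoint that admits both p and one of its partners. The default 0 is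
  -- immaterial, since `l` keeps only paths with a partner.
  set need₀ : ℕ → ℝ := fun p =>
    if h : (partners p).Nonempty then max (top p) ((partners p).inf' h top) else 0 with hneed₀
  set l : List ℕ := ((List.range N).filter fun p => (partners p).Nonempty).insertionSort
    fun p p' => low p' ≤ low p with hl
  have hlmem : ∀ p, p ∈ l ↔ p < N ∧ (partners p).Nonempty := by
    intro p
    rw [hl, List.mem_insertionSort, List.mem_filter, List.mem_range, decide_eq_true_eq]
  have hlnodup : l.Nodup := by
    rw [hl, (List.perm_insertionSort _ _).nodup_iff]
    exact List.nodup_range.filter _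
  have hlsorted : l.Pairwise fun p p' => low p' ≤ low p := by
    have : Std.Total fun p p' => low p' ≤ low p := ⟨fun p p' => le_total _ _⟩
    have : IsTrans ℕ fun p p' => low p' ≤ low p := ⟨fun _ _ _ h h' => h'.trans h⟩
    exact List.pairwise_insertionSort _ _
  set pos : ℕ → ℕ := fun j => l.getD j 0 with hpos
  have hposget : ∀ j (h : j < l.length), pos j = l[j] := fun j h => List.getD_eq_getElem _ _ h
  have hposmem : ∀ j < l.length, pos j < N ∧ (partners (pos j)).Nonempty := fun j h => by
    rw [← hlmem, hposget j h]; exact List.getElem_mem h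
  have hposle : ∀ j, pos j ≤ N := fun j => by
    by_cases h : j < l.length
    · exact (hposmem j h).1.le
    · simp only [hpos, List.getD_eq_default _ _ (not_lt.1 h)]; omega
  have hlen : l.length ≤ N := by
    rw [hl, List.length_insertionSort]
    exact (List.length_filter_le _ _).trans (by simp)
  set need : ℕ → ℕ → ℝ := fun m j => (Finset.Ico j (j + 2 ^ m)).inf'
    ⟨j, Finset.mem_Ico.2 ⟨le_rfl, by have : 0 < 2 ^ m := by positivity
                                     omega⟩⟩ (fun j => need₀ (pos j)) with hneed
  have hneedle : ∀ m j x, need m j ≤ x ↔ ∃ i, j ≤ i ∧ i < j + 2 ^ m ∧ need₀ (pos i) ≤ x := by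
    intro m j x
    exact (Finset.inf'_le_iff _).trans (by simp only [Finset.mem_Ico, and_assoc])
  have hneed0 : ∀ j x, need 0 j ≤ x ↔ need₀ (pos j) ≤ x := by
    intro j x
    rw [hneedle]
    constructor
    · rintro ⟨i, h1, h2, h3⟩
      rwa [show j = i by omega]
    · exact fun h => ⟨j, le_rfl, by omega, h⟩
  let D : Layout := ⟨N, l.length, vert, top, f, fun j => gs (pos j), pos, fun j => low (pos j), need⟩
  have hDint : D.interior r = int := rfl
  have hKpos : 0 < representativeBound r r := by
    cases r with
    | zero => simp [representativeBound]
    | succ r => simp only [representativeBound]; omega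
  refine ⟨D, ?_, rfl, rfl, fun j => (hgs _).trans (hposle j), hposle, fun x₁ x₂ => ?_⟩
  · constructor
    · exact hlen
    · exact hKpos
    · exact fun m j s _ _ => hf1 m j s
    · exact fun m j B i _ hB hi hi' hd => hf2 m j B hB i hi hi' hd
    · intro m j x _
      change need m j ≤ x ↔ ∃ i, j ≤ i ∧ i < j + 2 ^ m ∧ need 0 i ≤ x
      simp only [hneed0, hneedle]
    · exact fun j _ => hgs _
    · exact fun j hj => (hposmem j hj).1
    · intro i j hij hj
      change low (pos j) ≤ low (pos i)
      rcases hij.eq_or_lt with rfl | hij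
      · exact le_rfl
      rw [hposget j hj, hposget i (hij.trans hj)]
      exact List.pairwise_iff_getElem.1 hlsorted i j _ _ hij
    · intro j hj
      have hne := (hposmem j hj).2
      obtain ⟨i, hi, hie⟩ := Finset.exists_mem_eq_inf' hne top
      have hi' := hi
      rw [hpartners] at hi'
      simp only [Finset.mem_filter, Finset.mem_Ico] at hi'
      refine ⟨i, hi'.1.1, hi'.1.2, hi'.2, ?_⟩
      -- The partner attaining the infimum has top attribute at most the need, because the need is a
      -- maximum with that infimum.
      by_contra hlt
      have h1 : need 0 j ≤ need 0 j := le_rfl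
      rw [hneed0, hneed₀] at h1
      simp only [hne, dif_pos] at h1
      have h2 := (le_max_right _ _).trans h1
      rw [hie] at h2
      exact hlt h2
  · set pairs : List (ℕ × ℕ) := ((List.Ico 0 D.Nout).filter fun j =>
      D.need 0 j ≤ x₂ ∧ x₁ ≤ D.low j).flatMap fun j => ((List.Ico (D.start j) (D.pos j)).filter
        fun i => Disjoint (D.interior r i) (D.interior r (D.pos j)) ∧ D.top i ≤ x₂).map
          fun i => (D.pos j, i) with hpairs
    have hmem : ∀ p i, (p, i) ∈ pairs ↔ ∃ j < l.length, (need 0 j ≤ x₂ ∧ x₁ ≤ low (pos j)) ∧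
        (gs (pos j) ≤ i ∧ i < pos j) ∧ (Disjoint (int i) (int (pos j)) ∧ top i ≤ x₂) ∧
          pos j = p := by
      intro p i
      simp only [hpairs, List.mem_flatMap, List.mem_filter, List.mem_map, List.Ico.mem,
        decide_eq_true_eq, Prod.mk.injEq, Nat.zero_le, true_and]
      constructor
      · rintro ⟨j, ⟨hj, h1⟩, i', ⟨h2, h3⟩, h4, rfl⟩
        exact ⟨j, hj, h1, h2, h3, h4⟩
      · rintro ⟨j, hj, h1, h2, h3, h4⟩
        exact ⟨j, ⟨hj, h1⟩, i, ⟨h2, h3⟩, h4, rfl⟩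
    refine ⟨pairs, ?_, ?_, fun p i => ?_⟩
    · rw [hpairs, List.nodup_flatMap]
      constructor
      · intro j _
        exact ((List.Ico.nodup _ _).filter _).map fun a b h => (Prod.mk.inj h).2
      · have : (List.Ico 0 D.Nout).Pairwise fun j j' => pos j ≠ pos j' := by
          refine List.Pairwise.imp_of_mem ?_ (List.Ico.nodup 0 D.Nout)
          intro j j' hj hj' hne e
          rw [List.Ico.mem] at hj hj'
          rw [hposget j hj.2, hposget j' hj'.2] at e
          exact hne (hlnodup.getElem_inj_iff.1 e)
        refine (this.filter _).imp ?_
        intro j j' hne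
        rw [Function.onFun, List.disjoint_left]
        rintro ⟨p, i⟩ h1 h2
        simp only [List.mem_map, Prod.mk.injEq] at h1 h2
        obtain ⟨_, _, e1, _⟩ := h1
        obtain ⟨_, _, e2, _⟩ := h2
        exact hne (e1.trans e2.symm)
    · rw [hpairs, List.map_flatMap, Layout.outerList]
      congr 1
      funext j
      rw [List.map_map, Layout.innerList]
      rfl
    · rw [hmem]
      constructor
      · rintro ⟨j, hj, ⟨h1, h2⟩, ⟨h3, h4⟩, ⟨h5, h6⟩, rfl⟩
        have hne := (hposmem j hj).2
        rw [hneed0, hneed₀] at h1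
        simp only [hne, dif_pos] at h1
        exact ⟨(hposmem j hj).1, h3, h4, h5, h6, (le_max_left _ _).trans h1, h2⟩
      · rintro ⟨h1, h2, h3, h4, h5, h6, h7⟩
        have hi : i ∈ partners p := by
          rw [hpartners]
          exact Finset.mem_filter.2 ⟨Finset.mem_Ico.2 ⟨h2, h3⟩, h4⟩
        obtain ⟨j, hj, e⟩ := List.getElem_of_mem ((hlmem p).2 ⟨h1, i, hi⟩)
        have e' : pos j = p := (hposget j hj).trans e
        refine ⟨j, hj, ?_, ?_, ?_, e'⟩
        · rw [hneed0, e']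
          refine ⟨?_, h7⟩
          rw [hneed₀]
          simp only [show (partners p).Nonempty from ⟨i, hi⟩, dif_pos]
          exact max_le h6 ((Finset.inf'_le _ hi).trans h5)
        · rw [e']; exact ⟨h2, h3⟩
        · rw [e']; exact ⟨h4, h5⟩

section

open SimpleGraph

/-! ### Cycles -/

section
variable {V : Type*} {G : SimpleGraph V} {k : ℕ}

/-- `c` enumerates the vertices of a cycle of `G` in cyclic order. -/
structure IsCycleMap (G : SimpleGraph V) (c : Fin (k + 2) → V) : Prop where
  inj : Function.Injective c
  adj : ∀ t, G.Adj (c t) (c (t + 1))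

theorem IsCycleMap.map_adj {c : Fin (k + 2) → V} (h : IsCycleMap G c) {a b : Fin (k + 2)}
    (hab : (cycleGraph (k + 2)).Adj a b) : G.Adj (c a) (c b) := by
  rcases cycleGraph_adj.1 hab with h' | h'
  · rw [sub_eq_iff_eq_add'.1 h']; exact (h.adj b).symm
  · rw [sub_eq_iff_eq_add'.1 h']; exact h.adj a

/-- The copy of the cycle graph given by a cycle. -/
def IsCycleMap.copy {c : Fin (k + 2) → V} (h : IsCycleMap G c) : Copy (cycleGraph (k + 2)) G :=
  ⟨⟨c, fun hab => h.map_adj hab⟩, h.inj⟩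

theorem isCycleMap_copy (φ : Copy (cycleGraph (k + 2)) G) : IsCycleMap G φ :=
  ⟨φ.injective, fun t => φ.toHom.map_adj (cycleGraph_adj.2 (.inr (by simp)))⟩

theorem copy_mem_verts {W : Type*} {A : SimpleGraph W} (φ : Copy A G) (x : V) :
    x ∈ φ.toSubgraph.verts ↔ ∃ a, φ a = x := by
  simp [Copy.toSubgraph]

theorem copy_toSubgraph_adj {W : Type*} {A : SimpleGraph W} (φ : Copy A G) (x y : V) :
    φ.toSubgraph.Adj x y ↔ ∃ a b, A.Adj a b ∧ φ a = x ∧ φ b = y := by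
  simp [Copy.toSubgraph, Relation.Map]

theorem toSubgraph_le_of_comp {W : Type*} {A : SimpleGraph W} {φ φ' : Copy A G} (σ : W → W)
    (hσ : ∀ a b, A.Adj a b → A.Adj (σ a) (σ b)) (h : ∀ a, φ' a = φ (σ a)) :
    φ'.toSubgraph ≤ φ.toSubgraph := by
  constructor
  · intro x
    rw [copy_mem_verts, copy_mem_verts]
    rintro ⟨a, rfl⟩
    exact ⟨σ a, (h a).symm⟩
  · intro x y
    rw [copy_toSubgraph_adj, copy_toSubgraph_adj]
    rintro ⟨a, b, hab, rfl, rfl⟩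
    exact ⟨σ a, σ b, hσ a b hab, (h a).symm, (h b).symm⟩

theorem cycleGraph_adj_add {a b : Fin (k + 2)} (d : Fin (k + 2))
    (h : (cycleGraph (k + 2)).Adj a b) : (cycleGraph (k + 2)).Adj (a + d) (b + d) := by
  rw [cycleGraph_adj] at h ⊢
  simpa using h

theorem cycleGraph_adj_neg {a b : Fin (k + 2)}
    (h : (cycleGraph (k + 2)).Adj a b) : (cycleGraph (k + 2)).Adj (-a) (-b) := by
  rw [cycleGraph_adj] at h ⊢
  rw [neg_sub_neg, neg_sub_neg]
  exact h.symm

theorem IsCycleMap.add {c : Fin (k + 2) → V} (h : IsCycleMap G c) (d : Fin (k + 2)) :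
    IsCycleMap G fun t => c (t + d) :=
  ⟨fun a b e => add_right_cancel (h.inj e), fun t => by
    have := h.adj (t + d)
    rwa [add_right_comm] at this⟩

theorem IsCycleMap.neg {c : Fin (k + 2) → V} (h : IsCycleMap G c) :
    IsCycleMap G fun t => c (-t) :=
  ⟨fun a b e => neg_injective (h.inj e), fun t => by
    have := (h.adj (-(t + 1))).symm
    rwa [show -(t + 1) + 1 = -t by rw [neg_add, neg_add_cancel_right]] at this⟩

theorem toSubgraph_add (φ : Copy (cycleGraph (k + 2)) G) (d : Fin (k + 2)) :
    ((isCycleMap_copy φ).add d).copy.toSubgraph = φ.toSubgraph := by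
  apply le_antisymm
  · exact toSubgraph_le_of_comp (fun t => t + d) (fun a b => cycleGraph_adj_add d) fun _ => rfl
  · refine toSubgraph_le_of_comp (fun t => t + -d) (fun a b => cycleGraph_adj_add (-d)) fun t => ?_
    change φ t = φ (t + -d + d)
    rw [neg_add_cancel_right]

theorem IsCycleMap.toSubgraph_neg {c : Fin (k + 2) → V} (h : IsCycleMap G c) :
    h.neg.copy.toSubgraph = h.copy.toSubgraph := by
  apply le_antisymm
  · exact toSubgraph_le_of_comp (fun t => -t) (fun a b => cycleGraph_adj_neg) fun _ => rfl
  · refine toSubgraph_le_of_comp (fun t => -t) (fun a b => cycleGraph_adj_neg) fun t => ?_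
    change c t = c (- -t)
    rw [neg_neg]

/-- A cycle is determined by its subgraph and its first two vertices. -/
theorem IsCycleMap.eq_of_apply_one {c c' : Fin (k + 2) → V} (hk : k ≠ 0) (h : IsCycleMap G c)
    (h' : IsCycleMap G c') (hH : h.copy.toSubgraph = h'.copy.toSubgraph) (h0 : c' 0 = c 0)
    (h1 : c' 1 = c 1) : c' = c := by
  have key : ∀ j : ℕ, c' (j • 1) = c (j • 1) ∧ c' (j • 1 + 1) = c (j • 1 + 1) := by
    intro j
    induction j with
    | zero => simpa using ⟨h0, h1⟩
    | succ j ih =>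
      rw [succ_nsmul]
      generalize j • (1 : Fin (k + 2)) = j at ih ⊢
      refine ⟨ih.2, ?_⟩
      have hadj : h'.copy.toSubgraph.Adj (c' (j + 1)) (c' (j + 1 + 1)) :=
        (copy_toSubgraph_adj _ _ _).2 ⟨_, _, cycleGraph_adj.2 (.inr (by simp)), rfl, rfl⟩
      rw [← hH, copy_toSubgraph_adj] at hadj
      obtain ⟨a, d, had, ha, hd⟩ := hadj
      change c a = _ at ha
      change c d = _ at hd
      rw [ih.2] at ha
      have ha := h.inj ha
      subst ha
      rcases cycleGraph_adj.1 had with h2 | h2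
      -- A neighbour of c (j + 1) in the cycle is c j or c (j + 2). The former equals c' j by
      -- induction, and c' (j + 2) = c' j is impossible as 2 ≠ 0 modulo k + 2; this is where k ≠ 0
      -- enters.
      · have e : d = j := by
          rw [sub_eq_iff_eq_add'] at h2
          exact (add_right_cancel h2).symm
        rw [e, ← ih.1] at hd
        have := h'.inj hd
        exfalso
        have h3 : (1 + 1 : Fin (k + 2)) = 0 := by
          rwa [add_assoc, left_eq_add] at this
        have h4 := congrArg Fin.val h3
        rw [Fin.val_add, Fin.val_one, Fin.val_zero, Nat.mod_eq_of_lt (by omega)] at h4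
        omega
      · rw [sub_eq_iff_eq_add'] at h2
        rw [← hd, h2]
  have hsmul : ∀ (j : ℕ) (hj : j < k + 2), j • (1 : Fin (k + 2)) = ⟨j, hj⟩ := by
    intro j
    induction j with
    | zero => intro hj; rw [zero_nsmul]; rfl
    | succ j ih =>
      intro hj
      rw [succ_nsmul, ih (by omega)]
      apply Fin.ext
      rw [Fin.val_add, Fin.val_one]
      exact Nat.mod_eq_of_lt hj
  funext t
  have := (key t.val).1
  rwa [hsmul t.val t.isLt] at this

/-- A cycle is determined by its subgraph and its first vertex, up to reversal. -/
theorem IsCycleMap.eq_or_eq_neg {c c' : Fin (k + 2) → V} (hk : k ≠ 0) (h : IsCycleMap G c)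
    (h' : IsCycleMap G c') (hH : h.copy.toSubgraph = h'.copy.toSubgraph) (h0 : c' 0 = c 0) :
    c' = c ∨ c' = fun t => c (-t) := by
  have hadj : h'.copy.toSubgraph.Adj (c' 0) (c' 1) :=
    (copy_toSubgraph_adj _ _ _).2 ⟨0, 1, cycleGraph_adj.2 (.inr (by simp)), rfl, rfl⟩
  rw [← hH, copy_toSubgraph_adj] at hadj
  obtain ⟨a, d, had, ha, hd⟩ := hadj
  change c a = _ at ha
  change c d = _ at hd
  rw [h0] at ha
  have ha := h.inj ha
  subst ha
  rcases cycleGraph_adj.1 had with h2 | h2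
  · right
    refine h.neg.eq_of_apply_one hk h' (h.toSubgraph_neg.trans hH) ?_ ?_
    · simpa using h0
    · rw [← hd, ← h2]; simp
  · left
    refine h.eq_of_apply_one hk h' hH h0 ?_
    rw [← hd, ← h2, sub_zero]

end

/-! ### Rooted paths -/

section
variable {n r : ℕ} {G : SimpleGraph (Fin n)}

/-- `v` enumerates a path that starts at its least vertex. -/
structure IsRootedPath (G : SimpleGraph (Fin n)) (v : Fin (r + 2) → Fin n) : Prop where
  inj : Function.Injective v
  adj : ∀ (t : ℕ) (h : t + 1 < r + 2), G.Adj (v ⟨t, by omega⟩) (v ⟨t + 1, h⟩)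
  le : ∀ t, v 0 ≤ v t

/-- `v` and `w` have the same end points and no common inner vertex. -/
structure AreDisjointPaths (v w : Fin (r + 2) → Fin n) : Prop where
  zero : v 0 = w 0
  last : v (Fin.last _) = w (Fin.last _)
  ne : ∀ (a b : ℕ) (ha : a < r) (hb : b < r), v ⟨a + 1, by omega⟩ ≠ w ⟨b + 1, by omega⟩

theorem AreDisjointPaths.symm {v w : Fin (r + 2) → Fin n} (h : AreDisjointPaths v w) :
    AreDisjointPaths w v :=
  ⟨h.zero.symm, h.last.symm, fun a b ha hb e => h.ne b a hb ha e.symm⟩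

/-- The closed walk along `v` and back along `w`. -/
def joinPaths (v w : Fin (r + 2) → Fin n) (t : Fin (2 * r + 2)) : Fin n :=
  if h : t.val < r + 2 then v ⟨t, h⟩ else w ⟨2 * r + 2 - t, by omega⟩

theorem isCycleMap_joinPaths {v w : Fin (r + 2) → Fin n} (hv : IsRootedPath G v)
    (hw : IsRootedPath G w) (h : AreDisjointPaths v w) : IsCycleMap G (joinPaths v w) := by
  have hzero : v ⟨0, by omega⟩ = w ⟨0, by omega⟩ := h.zero
  have hlast : v ⟨r + 1, by omega⟩ = w ⟨r + 1, by omega⟩ := h.last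
  -- An end of `v` is also an end of `w`, so injectivity of `w` separates it from the inner vertices
  -- of `w`; for inner vertices of `v` this is disjointness.
  have hne : ∀ (a b : ℕ) (ha : a < r + 2) (hb : b < r + 2), 0 < b → b < r + 1 →
      v ⟨a, ha⟩ ≠ w ⟨b, hb⟩ := by
    intro a b ha hb hb0 hbr
    rcases Nat.eq_zero_or_pos a with rfl | ha0
    · rw [hzero, hw.inj.ne_iff]; simp; omega
    by_cases har : a = r + 1
    · subst har
      rw [hlast, hw.inj.ne_iff]; simp; omega
    obtain ⟨a, rfl⟩ := Nat.exists_eq_add_of_lt ha0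
    obtain ⟨b, rfl⟩ := Nat.exists_eq_add_of_lt hb0
    have := h.ne a b (by omega) (by omega)
    simpa using this
  constructor
  · rintro ⟨a, ha⟩ ⟨b, hb⟩ e
    simp only [joinPaths] at e
    rw [Fin.mk.injEq]
    split_ifs at e with h1 h2 h2
    · simpa using hv.inj e
    · exact absurd e (hne _ _ _ _ (by omega) (by omega))
    · exact absurd e.symm (hne _ _ _ _ (by omega) (by omega))
    · have := hw.inj e
      rw [Fin.mk.injEq] at this
      omega
  · rintro ⟨t, ht⟩
    by_cases ht' : t + 1 < 2 * r + 2
    · have e : (⟨t, ht⟩ + 1 : Fin (2 * r + 2)) = ⟨t + 1, ht'⟩ := by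
        apply Fin.ext
        rw [Fin.val_add, Fin.val_one]
        exact Nat.mod_eq_of_lt ht'
      rw [e]
      simp only [joinPaths]
      split_ifs with h1 h2 h2
      · exact hv.adj t h2
      · have e1 : t = r + 1 := by omega
        subst e1
        rw [hlast]
        have := (hw.adj r (by omega)).symm
        convert this using 3
        omega
      · omega
      · have := (hw.adj (2 * r + 2 - (t + 1)) (by omega)).symm
        convert this using 3
        omega
    · have e : (⟨t, ht⟩ + 1 : Fin (2 * r + 2)) = ⟨0, by omega⟩ := by
        apply Fin.ext
        rw [Fin.val_add, Fin.val_one]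
        have : t + 1 = 2 * r + 2 := by omega
        simp [this]
      rw [e]
      simp only [joinPaths]
      rw [dif_pos (show 0 < r + 2 by omega), hzero]
      have e2 : t = 2 * r + 1 := by omega
      subst e2
      split_ifs with h1
      -- The last position of the closed walk lies on `v` only if there are no inner vertices.
      · have e3 : r = 0 := by omega
        subst e3
        have := (hv.adj 0 (by omega)).symm
        rw [← hzero]
        exact this
      · have := (hw.adj 0 (by omega)).symm
        convert this using 3
        omega

theorem joinPaths_zero (v w : Fin (r + 2) → Fin n) : joinPaths v w 0 = v 0 := by
  simp [joinPaths]

theorem joinPaths_left (v w : Fin (r + 2) → Fin n) (t : ℕ) (h : t < r + 2)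
    (h' : t < 2 * r + 2) : joinPaths v w ⟨t, h'⟩ = v ⟨t, h⟩ := by
  rw [joinPaths, dif_pos h]

theorem joinPaths_right {v w : Fin (r + 2) → Fin n} (hvw : AreDisjointPaths v w) (t : ℕ)
    (h0 : 0 < t) (h : t < r + 2) (h' : 2 * r + 2 - t < 2 * r + 2) :
    joinPaths v w ⟨2 * r + 2 - t, h'⟩ = w ⟨t, h⟩ := by
  have hlast : v ⟨r + 1, by omega⟩ = w ⟨r + 1, by omega⟩ := hvw.last
  simp only [joinPaths]
  split_ifs with h1
  · have e1 : t = r + 1 := by omega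
    subst e1
    rw [← hlast]
    congr 2
    omega
  · congr 2
    omega

/-- Exchanging the two paths reverses the walk around the common starting vertex. The cycle
therefore depends only on the unordered pair. -/
theorem joinPaths_swap {v w : Fin (r + 2) → Fin n} (h : AreDisjointPaths v w) :
    (fun t => joinPaths v w (-t)) = joinPaths w v := by
  funext ⟨t, ht⟩
  rcases Nat.eq_zero_or_pos t with rfl | ht0
  · have : -(⟨0, ht⟩ : Fin (2 * r + 2)) = 0 := by
      have : (⟨0, ht⟩ : Fin (2 * r + 2)) = 0 := rfl
      rw [this, neg_zero]
    rw [this, joinPaths_zero, h.zero]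
    exact (joinPaths_zero w v).symm
  have e : -(⟨t, ht⟩ : Fin (2 * r + 2)) = ⟨2 * r + 2 - t, by omega⟩ := by
    apply Fin.ext
    rw [Fin.val_neg']
    change (2 * r + 2 - t) % (2 * r + 2) = 2 * r + 2 - t
    exact Nat.mod_eq_of_lt (by omega)
  rw [e]
  by_cases h1 : t < r + 2
  · rw [joinPaths_left w v t h1 ht, joinPaths_right h t ht0 h1]
  · have := joinPaths_right h.symm (2 * r + 2 - t) (by omega) (by omega) (by omega)
    rw [joinPaths_left v w _ (by omega), ← this]
    congr 2
    omega

theorem joinPaths_injective {v w v' w' : Fin (r + 2) → Fin n} (h : AreDisjointPaths v w)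
    (h' : AreDisjointPaths v' w') (e : joinPaths v w = joinPaths v' w') : v = v' ∧ w = w' := by
  have hv : v = v' := by
    funext ⟨t, ht⟩
    by_cases h2 : t < 2 * r + 2
    · rw [← joinPaths_left v w t ht h2, e, joinPaths_left]
    · omega
  refine ⟨hv, ?_⟩
  funext ⟨t, ht⟩
  rcases Nat.eq_zero_or_pos t with rfl | ht0
  · exact (h.zero.symm.trans (congrFun hv 0)).trans h'.zero
  · rw [← joinPaths_right h t ht0 ht (by omega), e, joinPaths_right h']
    exact ht0

end

end

/-! ### Cycles as pairs of rooted paths, and their sorted list -/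

section

open SimpleGraph

section
variable {n r : ℕ} {G : SimpleGraph (Fin n)}

theorem joinPaths_zero_le {v w : Fin (r + 2) → Fin n} (hv : IsRootedPath G v)
    (hw : IsRootedPath G w) (h : AreDisjointPaths v w) (t : Fin (2 * r + 2)) :
    joinPaths v w 0 ≤ joinPaths v w t := by
  rw [joinPaths_zero]
  unfold joinPaths
  split_ifs
  · exact hv.le _
  · rw [h.zero]; exact hw.le _

/-- The cycle formed by two disjoint paths with the same end points. -/
def cycleOf {v w : Fin (r + 2) → Fin n} (hv : IsRootedPath G v) (hw : IsRootedPath G w)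
    (h : AreDisjointPaths v w) : G.Subgraph := (isCycleMap_joinPaths hv hw h).copy.toSubgraph

theorem mem_cycleOf {v w : Fin (r + 2) → Fin n} {hv : IsRootedPath G v} {hw : IsRootedPath G w}
    {h : AreDisjointPaths v w} {x : Fin n} :
    x ∈ (cycleOf hv hw h).verts ↔ ∃ t, joinPaths v w t = x :=
  copy_mem_verts _ _

theorem mem_cycleOf_iff {v w : Fin (r + 2) → Fin n} {hv : IsRootedPath G v}
    {hw : IsRootedPath G w} {h : AreDisjointPaths v w} {x : Fin n} :
    x ∈ (cycleOf hv hw h).verts ↔ (∃ t, v t = x) ∨ ∃ t, w t = x := by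
  rw [mem_cycleOf]
  constructor
  · rintro ⟨t, rfl⟩
    unfold joinPaths
    split_ifs
    exacts [.inl ⟨_, rfl⟩, .inr ⟨_, rfl⟩]
  · rintro (⟨⟨t, ht⟩, rfl⟩ | ⟨⟨t, ht⟩, rfl⟩)
    · exact ⟨⟨t, by omega⟩, joinPaths_left v w t ht _⟩
    · rcases Nat.eq_zero_or_pos t with rfl | ht0
      · exact ⟨0, (joinPaths_zero v w).trans h.zero⟩
      · exact ⟨⟨2 * r + 2 - t, by omega⟩, joinPaths_right h t ht0 ht _⟩

theorem describes_cycleOf {v w : Fin (r + 2) → Fin n} (hv : IsRootedPath G v)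
    (hw : IsRootedPath G w) (h : AreDisjointPaths v w) :
    Describes (cycleGraph (2 * r + 2)) (cycleOf hv hw h)
      (List.ofFn fun t => (joinPaths v w t : ℕ)) :=
  ⟨(isCycleMap_joinPaths hv hw h).copy.isoToSubgraph, rfl⟩

/-- Both walks start at the least vertex of the common subgraph, so they agree up to reversal, and
reversal exchanges the two paths. -/
theorem cycleOf_inj (hr : r ≠ 0) {v w v' w' : Fin (r + 2) → Fin n} {hv : IsRootedPath G v}
    {hw : IsRootedPath G w} {h : AreDisjointPaths v w} {hv' : IsRootedPath G v'}
    {hw' : IsRootedPath G w'} {h' : AreDisjointPaths v' w'}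
    (e : cycleOf hv hw h = cycleOf hv' hw' h') : (v = v' ∧ w = w') ∨ (v = w' ∧ w = v') := by
  have h0 : joinPaths v' w' 0 = joinPaths v w 0 := by
    apply le_antisymm
    · have : joinPaths v w 0 ∈ (cycleOf hv' hw' h').verts := e ▸ mem_cycleOf.2 ⟨0, rfl⟩
      obtain ⟨t, ht⟩ := mem_cycleOf.1 this
      exact ht ▸ joinPaths_zero_le hv' hw' h' t
    · have : joinPaths v' w' 0 ∈ (cycleOf hv hw h).verts := e ▸ mem_cycleOf.2 ⟨0, rfl⟩
      obtain ⟨t, ht⟩ := mem_cycleOf.1 this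
      exact ht ▸ joinPaths_zero_le hv hw h t
  rcases (isCycleMap_joinPaths hv hw h).eq_or_eq_neg (by omega)
    (isCycleMap_joinPaths hv' hw' h') e h0 with h1 | h1
  · have := joinPaths_injective h' h h1
    exact .inl ⟨this.1.symm, this.2.symm⟩
  · rw [joinPaths_swap h] at h1
    have := joinPaths_injective h' h.symm h1
    exact .inr ⟨this.2.symm, this.1.symm⟩

theorem cycleOf_symm {v w : Fin (r + 2) → Fin n} (hv : IsRootedPath G v) (hw : IsRootedPath G w)
    (h : AreDisjointPaths v w) : cycleOf hw hv h.symm = cycleOf hv hw h := by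
  rw [cycleOf, cycleOf, ← (isCycleMap_joinPaths hv hw h).toSubgraph_neg]
  congr 2
  exact (joinPaths_swap h).symm

theorem IsCycleMap.isRootedPath {c : Fin (2 * r + 2) → Fin n} (h : IsCycleMap G c)
    (h0 : ∀ t, c 0 ≤ c t) : IsRootedPath G fun t : Fin (r + 2) => c ⟨t, by omega⟩ := by
  refine ⟨fun a b e => ?_, fun t ht => ?_, fun t => h0 _⟩
  · have := h.inj e
    rw [Fin.mk.injEq] at this
    exact Fin.ext this
  · have := h.adj ⟨t, by omega⟩
    convert this using 2
    apply Fin.ext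
    rw [Fin.val_add, Fin.val_one]
    exact (Nat.mod_eq_of_lt (by omega)).symm

/-- Every cycle is formed by two disjoint paths that start at its least vertex. -/
theorem exists_cycleOf_eq {H : G.Subgraph} (hH : H ∈ occurrences (cycleGraph (2 * r + 2)) G) :
    ∃ (v w : Fin (r + 2) → Fin n) (hv : IsRootedPath G v) (hw : IsRootedPath G w)
      (h : AreDisjointPaths v w), cycleOf hv hw h = H := by
  have hH' : H ∈ Set.range (Copy.toSubgraph (A := cycleGraph (2 * r + 2)) (B := G)) := by
    rw [Copy.range_toSubgraph]; exact hH
  obtain ⟨φ, rfl⟩ := hH'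
  -- The enumeration is rotated to start at the least vertex. Its first half, forwards and backwards
  -- from there, gives the two paths.
  obtain ⟨a, ha⟩ := Finite.exists_min φ
  set c : Fin (2 * r + 2) → Fin n := fun t => φ (t + a) with hc
  have hcyc : IsCycleMap G c := (isCycleMap_copy φ).add a
  have h0 : ∀ t, c 0 ≤ c t := fun t => by
    simp only [hc, zero_add]; exact ha _
  have hneg : ∀ (t : ℕ) (_ : 0 < t) (ht : t < 2 * r + 2),
      -(⟨t, ht⟩ : Fin (2 * r + 2)) = ⟨2 * r + 2 - t, by omega⟩ := by
    intro t ht0 ht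
    apply Fin.ext
    rw [Fin.val_neg']
    change (2 * r + 2 - t) % (2 * r + 2) = 2 * r + 2 - t
    exact Nat.mod_eq_of_lt (by omega)
  have hv := hcyc.isRootedPath h0
  have hw := hcyc.neg.isRootedPath (r := r) (fun t => by simpa using h0 (-t))
  have hd : AreDisjointPaths (fun t : Fin (r + 2) => c ⟨t, by omega⟩)
      (fun t : Fin (r + 2) => c (-⟨t, by omega⟩)) := by
    refine ⟨?_, ?_, fun a b ha hb e => ?_⟩
    · congr 1
      exact neg_zero.symm
    · simp only [Fin.val_last]
      rw [hneg (r + 1) (by omega)]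
      congr 2
      omega
    · simp only at e
      rw [hneg (b + 1) (by omega)] at e
      have := hcyc.inj e
      rw [Fin.mk.injEq] at this
      omega
  refine ⟨_, _, hv, hw, hd, ?_⟩
  have e : joinPaths (fun t : Fin (r + 2) => c ⟨t, by omega⟩)
      (fun t : Fin (r + 2) => c (-⟨t, by omega⟩)) = c := by
    funext ⟨t, ht⟩
    simp only [joinPaths]
    split_ifs with h1
    · rfl
    · rw [hneg (2 * r + 2 - t) (by omega)]
      congr 2
      omega
  rw [← toSubgraph_add φ a, cycleOf]
  congr 2

/-- There are at most as many rooted paths as paths, up to a constant factor. -/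
theorem card_rootedPaths_le (l : List (Fin (r + 2) → Fin n)) (hl : l.Nodup)
    (h : ∀ v ∈ l, IsRootedPath G v) :
    l.length ≤ (r + 2) ^ (r + 2) * numPaths (r + 1) G := by
  classical
  have hcopy : ∀ v, IsRootedPath G v →
      ∃ φ : Copy (pathGraph (r + 2)) G, ∀ t, φ t = v t := by
    intro v hv
    refine ⟨⟨⟨v, ?_⟩, hv.inj⟩, fun _ => rfl⟩
    intro a b hab
    rcases pathGraph_adj.1 hab with e | e
    · have := hv.adj a (by omega)
      convert this using 2
      exact Fin.ext e.symm
    · have := (hv.adj b (by omega)).symm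
      convert this using 2
      exact Fin.ext e.symm
  choose φ hφ using hcopy
  have hfin : (occurrences (pathGraph (r + 2)) G).Finite := Set.toFinite _
  have hle := Finset.card_le_mul_card_image_of_maps_to (s := l.toFinset) (t := hfin.toFinset)
    (f := fun v => if hv : IsRootedPath G v then (φ v hv).toSubgraph else ⊥) ?_
    ((r + 2) ^ (r + 2)) ?_
  · rw [List.toFinset_card_of_nodup hl, ← Set.ncard_eq_toFinset_card] at hle
    exact hle
  · intro v hv
    have hv := h v (List.mem_toFinset.1 hv)
    simp only [hv, dif_pos, Set.Finite.mem_toFinset]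
    exact ⟨(φ v hv).isoToSubgraph⟩
  · intro H _
    rcases (Finset.filter (fun v => (if hv : IsRootedPath G v then (φ v hv).toSubgraph else ⊥) = H)
      l.toFinset).eq_empty_or_nonempty with he | ⟨v₀, hv₀⟩
    · rw [he]; simp
    have hrange : ∀ v ∈ l, (if hv : IsRootedPath G v then (φ v hv).toSubgraph else ⊥) = H →
        ∀ x, x ∈ H.verts ↔ ∃ t, v t = x := by
      rintro v hv rfl x
      simp only [h v hv, dif_pos]
      rw [copy_mem_verts]
      simp only [hφ v (h v hv)]
    rw [Finset.mem_filter, List.mem_toFinset] at hv₀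
    -- Sequences with the same subgraph take their r + 2 values among the at most r + 2 vertices of
    -- one of them, `v₀`.
    refine (Finset.card_le_card (t := Fintype.piFinset fun _ => Finset.univ.image v₀) ?_).trans ?_
    · intro v hv
      rw [Finset.mem_filter, List.mem_toFinset] at hv
      rw [Fintype.mem_piFinset]
      intro t
      have := (hrange v hv.1 hv.2 (v t)).2 ⟨t, rfl⟩
      rw [hrange v₀ hv₀.1 hv₀.2] at this
      simpa using this
    · rw [Fintype.card_piFinset]
      simp only [Finset.prod_const, Finset.card_univ, Fintype.card_fin]
      refine Nat.pow_le_pow_left (Finset.card_image_le.trans ?_) _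
      simp

/-! ### The sorted list of rooted paths -/

/-- The smallest attribute on `v`. -/
noncomputable def lowAttr (A : Fin n → ℝ) (v : Fin (r + 2) → Fin n) : ℝ :=
  Finset.univ.inf' Finset.univ_nonempty fun t => A (v t)

/-- The largest attribute on `v`. -/
noncomputable def topAttr (A : Fin n → ℝ) (v : Fin (r + 2) → Fin n) : ℝ :=
  Finset.univ.sup' Finset.univ_nonempty fun t => A (v t)

theorem le_lowAttr {A : Fin n → ℝ} {v : Fin (r + 2) → Fin n} {x : ℝ} :
    x ≤ lowAttr A v ↔ ∀ t, x ≤ A (v t) := by simp [lowAttr]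

theorem topAttr_le {A : Fin n → ℝ} {v : Fin (r + 2) → Fin n} {x : ℝ} :
    topAttr A v ≤ x ↔ ∀ t, A (v t) ≤ x := by simp [topAttr]

/-- The end points of `v`, ordered lexicographically. -/
def endPoints (v : Fin (r + 2) → Fin n) : Fin n ×ₗ Fin n := toLex (v 0, v (Fin.last _))

/-- The sorting key: first the end points, then decreasing smallest attributes. -/
noncomputable def pathKey (A : Fin n → ℝ) (v : Fin (r + 2) → Fin n) :
    (Fin n ×ₗ Fin n) ×ₗ ℝᵒᵈ := toLex (endPoints v, OrderDual.toDual (lowAttr A v))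

theorem endPoints_le_of_pathKey_le {A : Fin n → ℝ} {v w : Fin (r + 2) → Fin n}
    (h : pathKey A v ≤ pathKey A w) : endPoints v ≤ endPoints w := by
  rcases Prod.Lex.toLex_le_toLex.1 h with h | h
  exacts [h.le, h.1.le]

theorem lowAttr_le_of_pathKey_le {A : Fin n → ℝ} {v w : Fin (r + 2) → Fin n}
    (h : pathKey A v ≤ pathKey A w) (e : endPoints v = endPoints w) :
    lowAttr A w ≤ lowAttr A v := by
  rcases Prod.Lex.toLex_le_toLex.1 h with h | h
  exacts [absurd e h.ne, OrderDual.toDual_le_toDual.1 h.2]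

theorem exists_sorted_rootedPaths (r : ℕ) (G : SimpleGraph (Fin n)) (A : Fin n → ℝ) :
    ∃ l : List (Fin (r + 2) → Fin n), l.Nodup ∧ (∀ v, v ∈ l ↔ IsRootedPath G v) ∧
      l.Pairwise fun v w => pathKey A v ≤ pathKey A w := by
  classical
  refine ⟨(Finset.univ.filter fun v => IsRootedPath G v).toList.insertionSort
    fun v w => pathKey A v ≤ pathKey A w, ?_, fun v => ?_, ?_⟩
  · rw [(List.perm_insertionSort _ _).nodup_iff]
    exact Finset.nodup_toList _
  · simp [List.mem_insertionSort]
  · have : Std.Total fun v w : Fin (r + 2) → Fin n => pathKey A v ≤ pathKey A w :=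
      ⟨fun _ _ => le_total _ _⟩
    have : IsTrans (Fin (r + 2) → Fin n) fun v w => pathKey A v ≤ pathKey A w :=
      ⟨fun _ _ _ h h' => h.trans h'⟩
    exact List.pairwise_insertionSort _ _

end

end

/-! ### Cycles in range and the layout of their paths -/

section

open SimpleGraph

variable {n r : ℕ} {G : SimpleGraph (Fin n)}

/-- The range subgraph is induced, so containment is a condition on vertices only, and these are the
vertices of the two paths. -/
theorem mem_rangeOccurrences_cycleOf {A : Fin n → ℝ} {x₁ x₂ : ℝ} {v w : Fin (r + 2) → Fin n}
    {hv : IsRootedPath G v} {hw : IsRootedPath G w} {h : AreDisjointPaths v w} :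
    cycleOf hv hw h ∈ rangeOccurrences (cycleGraph (2 * r + 2)) G A x₁ x₂ ↔
      (x₁ ≤ lowAttr A v ∧ topAttr A v ≤ x₂) ∧ (x₁ ≤ lowAttr A w ∧ topAttr A w ≤ x₂) := by
  have hocc : cycleOf hv hw h ∈ occurrences (cycleGraph (2 * r + 2)) G :=
    ⟨(isCycleMap_joinPaths hv hw h).copy.isoToSubgraph⟩
  have hle : cycleOf hv hw h ≤ rangeSubgraph G A x₁ x₂ ↔
      ∀ x ∈ (cycleOf hv hw h).verts, x₁ ≤ A x ∧ A x ≤ x₂ := by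
    constructor
    · exact fun hle x hx => hle.1 hx
    · intro hx
      refine ⟨hx, fun x y hxy => ?_⟩
      simp only [rangeSubgraph, Subgraph.induce_adj, Set.mem_ofPred_eq, Subgraph.top_adj]
      exact ⟨hx x ((cycleOf hv hw h).edge_vert hxy), hx y ((cycleOf hv hw h).edge_vert hxy.symm),
        (cycleOf hv hw h).adj_sub hxy⟩
  simp only [rangeOccurrences, Set.mem_ofPred_eq, hocc, true_and, hle, mem_cycleOf_iff, le_lowAttr,
    topAttr_le]
  constructor
  · intro hx
    exact ⟨⟨fun t => (hx _ (.inl ⟨t, rfl⟩)).1, fun t => (hx _ (.inl ⟨t, rfl⟩)).2⟩,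
      fun t => (hx _ (.inr ⟨t, rfl⟩)).1, fun t => (hx _ (.inr ⟨t, rfl⟩)).2⟩
  · rintro ⟨h1, h2⟩ x (⟨t, rfl⟩ | ⟨t, rfl⟩)
    exacts [⟨h1.1 t, h1.2 t⟩, ⟨h2.1 t, h2.2 t⟩]

/-- A layout by which the query lists the cycles in range. -/
theorem exists_cycle_layout (hr : r ≠ 0) (G : SimpleGraph (Fin n)) (A : Fin n → ℝ) :
    ∃ D : Layout, D.Valid (representativeBound r r) r ∧ D.N ≤ n ^ (r + 2) ∧
      D.N ≤ (r + 2) ^ (r + 2) * numPaths (r + 1) G ∧ (∀ j, D.start j ≤ D.N) ∧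
      (∀ j, D.pos j ≤ D.N) ∧ (∀ i t, D.vert i t ≤ n) ∧ ∀ x₁ x₂ : ℝ, ∃ Hs : List G.Subgraph,
        List.Forall₂ (Describes (cycleGraph (2 * r + 2))) Hs (D.outerList r x₁ x₂ 0) ∧ Hs.Nodup ∧
        ∀ H, H ∈ Hs ↔ H ∈ rangeOccurrences (cycleGraph (2 * r + 2)) G A x₁ x₂ := by
  classical
  obtain ⟨l, hnodup, hmem, hsorted⟩ := exists_sorted_rootedPaths r G A
  have hroot : ∀ i (hi : i < l.length), IsRootedPath G l[i] := fun i hi =>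
    (hmem _).1 (List.getElem_mem hi)
  have hget : ∀ i (hi : i < l.length), l[i]? = some l[i] := fun i hi =>
    List.getElem?_eq_getElem hi
  set vert : ℕ → ℕ → ℕ := fun i t => (l[i]?).elim 0 fun v => if h : t < r + 2 then v ⟨t, h⟩ else 0
    with hvert
  have hvert' : ∀ i (hi : i < l.length) t (ht : t < r + 2), vert i t = l[i] ⟨t, ht⟩ := by
    intro i hi t ht
    simp [hvert, hget i hi, ht]
  set top : ℕ → ℝ := fun i => (l[i]?).elim 0 (topAttr A) with htop
  have htop' : ∀ i (hi : i < l.length), top i = topAttr A l[i] := by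
    intro i hi
    simp [htop, hget i hi]
  set low : ℕ → ℝ := fun i => (l[i]?).elim 0 (lowAttr A) with hlow
  have hlow' : ∀ i (hi : i < l.length), low i = lowAttr A l[i] := by
    intro i hi
    simp [hlow, hget i hi]
  set ends : ℕ → Option (Fin n ×ₗ Fin n) := fun i => (l[i]?).map endPoints with hends
  have hends' : ∀ i (hi : i < l.length), ends i = some (endPoints l[i]) := by
    intro i hi
    simp [hends, hget i hi]
  -- The least such index is where the group of p begins. Indices past the list have the value
  -- `none`, so it is defined for every p.
  have hex : ∀ p, ∃ i, ends i = ends p := fun p => ⟨p, rfl⟩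
  have hkey : ∀ i p (hp : p < l.length) (hip : i ≤ p), pathKey A l[i] ≤ pathKey A l[p] := by
    intro i p hp hip
    rcases hip.eq_or_lt with rfl | hlt
    · exact le_rfl
    · exact List.pairwise_iff_getElem.1 hsorted i p _ _ hlt
  -- Groups are intervals because the end points come first in the sorting key: those of a path
  -- between two members of a group are squeezed from both sides.
  have hgroup : ∀ i p (hp : p < l.length) (hip : i < p), Nat.find (hex p) ≤ i ↔
      endPoints l[i] = endPoints l[p] := by
    intro i p hp hip
    constructor
    · intro hle
      have hg : Nat.find (hex p) < l.length := by omega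
      have e := Option.some.inj <|
        (hends' _ hg).symm.trans ((Nat.find_spec (hex p)).trans (hends' _ hp))
      refine le_antisymm (endPoints_le_of_pathKey_le (hkey _ _ hp hip.le)) ?_
      rw [← e]
      exact endPoints_le_of_pathKey_le (hkey _ _ (hip.trans hp) hle)
    · intro e
      refine Nat.find_min' _ ?_
      rw [hends' _ (hip.trans hp), hends' _ hp, e]
  obtain ⟨D, hD, hN, hDv, hstart, hpos, hpairs⟩ := exists_layout r l.length vert top low
    (fun p => Nat.find (hex p)) (fun p => Nat.find_min' _ rfl)
  have hdisj : ∀ i p (hi : i < l.length) (hp : p < l.length), endPoints l[i] = endPoints l[p] →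
      (Disjoint (D.interior r i) (D.interior r p) ↔ AreDisjointPaths l[p] l[i]) := by
    intro i p hi hp e
    have e' : l[i] 0 = l[p] 0 ∧ l[i] (Fin.last _) = l[p] (Fin.last _) := Prod.mk.inj (toLex_inj.1 e)
    simp only [Layout.interior, hDv, Finset.disjoint_left, Finset.mem_image, Finset.mem_range]
    constructor
    · intro hd
      refine ⟨e'.1.symm, e'.2.symm, fun a b ha hb hab => ?_⟩
      refine hd ⟨b, hb, rfl⟩ ⟨a, ha, ?_⟩
      rw [hvert' p hp _ (by omega), hvert' i hi _ (by omega), hab]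
    · rintro hd x ⟨b, hb, rfl⟩ ⟨a, ha, hab⟩
      rw [hvert' p hp _ (by omega), hvert' i hi _ (by omega)] at hab
      exact hd.ne a b ha hb (Fin.ext hab)
  -- `cycleOf` requires proofs; a total function of the pair is needed to map over the list. The
  -- value `⊥` for the other pairs is a filler.
  have hcyc : ∀ q : ℕ × ℕ, ∃ H : G.Subgraph, ∀ (hp : q.1 < l.length) (hi : q.2 < l.length)
      (h : AreDisjointPaths l[q.1] l[q.2]), H = cycleOf (hroot _ hp) (hroot _ hi) h := by
    intro q
    by_cases h : ∃ (hp : q.1 < l.length) (hi : q.2 < l.length), AreDisjointPaths l[q.1] l[q.2]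
    · obtain ⟨hp, hi, h⟩ := h
      exact ⟨cycleOf (hroot _ hp) (hroot _ hi) h, fun _ _ _ => rfl⟩
    · exact ⟨⊥, fun hp hi h' => (h ⟨hp, hi, h'⟩).elim⟩
  choose cyc hcyc using hcyc
  refine ⟨D, hD, ?_, hN ▸ card_rootedPaths_le l hnodup fun v hv => (hmem v).1 hv,
    hN ▸ hstart, hN ▸ hpos, ?_, fun x₁ x₂ => ?_⟩
  · rw [hN, ← List.toFinset_card_of_nodup hnodup]
    refine (Finset.card_le_univ _).trans ?_
    simp
  · intro i t
    rw [hDv]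
    by_cases hi : i < l.length
    · by_cases ht : t < r + 2
      · rw [hvert' i hi t ht]; exact (Fin.is_lt _).le
      · simp [hvert, hget i hi, ht]
    · simp [hvert, List.getElem?_eq_none (not_lt.1 hi)]
  · obtain ⟨pairs, hpn, hlist, hpm⟩ := hpairs x₁ x₂
    have hpm' : ∀ p i, (p, i) ∈ pairs ↔ ∃ (hp : p < l.length) (hi : i < p),
        AreDisjointPaths l[p] l[i] ∧ topAttr A l[i] ≤ x₂ ∧ topAttr A l[p] ≤ x₂ ∧
          x₁ ≤ lowAttr A l[p] := by
      intro p i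
      rw [hpm]
      constructor
      · rintro ⟨hp, hg, hi, hd, h1, h2, h3⟩
        rw [hgroup i p hp hi] at hg
        rw [hdisj i p (hi.trans hp) hp hg] at hd
        rw [htop' _ (hi.trans hp)] at h1
        rw [htop' _ hp] at h2
        rw [hlow' _ hp] at h3
        exact ⟨hp, hi, hd, h1, h2, h3⟩
      · rintro ⟨hp, hi, hd, h1, h2, h3⟩
        have e : endPoints l[i] = endPoints l[p] := by
          rw [endPoints, endPoints, hd.zero, hd.last]
        rw [hgroup i p hp hi, hdisj i p (hi.trans hp) hp e, htop' _ (hi.trans hp), htop' _ hp,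
          hlow' _ hp]
        exact ⟨hp, e, hi, hd, h1, h2, h3⟩
    have hcycle : ∀ p i (hp : p < l.length) (hi : i < l.length),
        D.cycle r p i = List.ofFn fun t => (joinPaths l[p] l[i] t : ℕ) := by
      intro p i hp hi
      apply List.ext_getElem
      · simp [Layout.cycle]; omega
      · intro t h1 h2
        rw [List.length_ofFn] at h2
        rw [List.getElem_ofFn]
        simp only [Layout.cycle, hDv, joinPaths]
        rw [List.getElem_append]
        simp only [List.length_map, List.length_range, List.getElem_map, List.getElem_range]
        split_ifs with h3
        · exact hvert' p hp t h3
        · rw [hvert' i hi _ (by omega)]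
          exact congrArg (fun m => (l[i] m : ℕ)) (Fin.ext (by
            change r - (t - (r + 2)) = 2 * r + 2 - t; omega))
    refine ⟨pairs.map cyc, ?_, ?_, fun H => ?_⟩
    · rw [hlist, List.forall₂_map_left_iff, List.forall₂_map_right_iff, List.forall₂_same]
      rintro ⟨p, i⟩ hq
      obtain ⟨hp, hi, hd, -⟩ := (hpm' p i).1 hq
      rw [hcyc (p, i) hp (hi.trans hp) hd, hcycle p i hp (hi.trans hp)]
      exact describes_cycleOf _ _ _
    · refine hpn.map_on ?_
      rintro ⟨p, i⟩ hq ⟨p', i'⟩ hq' e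
      obtain ⟨hp, hi, hd, -⟩ := (hpm' p i).1 hq
      obtain ⟨hp', hi', hd', -⟩ := (hpm' p' i').1 hq'
      rw [hcyc (p, i) hp (hi.trans hp) hd, hcyc (p', i') hp' (hi'.trans hp') hd'] at e
      rcases cycleOf_inj hr e with ⟨h1, h2⟩ | ⟨h1, h2⟩
      · rw [(hnodup.getElem_inj_iff.1 h1 : p = p'), (hnodup.getElem_inj_iff.1 h2 : i = i')]
      · have h1 : p = i' := hnodup.getElem_inj_iff.1 h1
        have h2 : i = p' := hnodup.getElem_inj_iff.1 h2
        omega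
    · rw [List.mem_map]
      constructor
      · rintro ⟨⟨p, i⟩, hq, rfl⟩
        obtain ⟨hp, hi, hd, h1, h2, h3⟩ := (hpm' p i).1 hq
        rw [hcyc (p, i) hp (hi.trans hp) hd, mem_rangeOccurrences_cycleOf]
        -- The listing tested x₁ only on p. The order inside the group transfers the bound to i,
        -- which comes earlier.
        refine ⟨⟨h3, h2⟩, h3.trans ?_, h1⟩
        refine lowAttr_le_of_pathKey_le (hkey i p hp hi.le) ?_
        rw [endPoints, endPoints, hd.zero, hd.last]
      · intro hH
        obtain ⟨v, w, hv, hw, hd, rfl⟩ := exists_cycleOf_eq hH.1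
        rw [mem_rangeOccurrences_cycleOf] at hH
        obtain ⟨p, hp, rfl⟩ := List.getElem_of_mem ((hmem v).2 hv)
        obtain ⟨i, hi, rfl⟩ := List.getElem_of_mem ((hmem w).2 hw)
        -- The unordered pair is listed once, with the larger index first. Equality is excluded
        -- since a path with r ≥ 1 inner vertices is not disjoint from itself.
        rcases lt_trichotomy i p with hip | rfl | hip
        · exact ⟨(p, i), (hpm' p i).2 ⟨hp, hip, hd, hH.2.2, hH.1.2, hH.1.1⟩, hcyc (p, i) hp hi hd⟩
        · exact (hd.ne 0 0 (by omega) (by omega) rfl).elim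
        · refine ⟨(i, p), (hpm' i p).2 ⟨hi, hip, hd.symm, hH.1.2, hH.2.2, hH.2.1⟩, ?_⟩
          rw [hcyc (i, p) hi hp hd.symm]
          exact cycleOf_symm hv hw hd

end

/-! ### The bounds -/

/-- The delay is affine in the number of levels, with coefficients depending on `K` and `r` only. -/
theorem Program.queryDelay_le (K r : ℕ) {L a g : ℕ} (hL : L ≤ g * a) (hg : 1 ≤ g) :
    queryDelay K r L ≤ queryDelay K r a * g := by
  simp only [queryDelay, roundTime, findNextTime]
  generalize (liftStep (innerCheck K r) 5 6).cost + 1 = u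
  generalize (liftStep (outerCheck K) 4 1).cost + 1 = v
  generalize (emitCycle K r).cost = w
  generalize (tryLoad K r).cost = z
  have h1 : L * u ≤ g * (a * u) := by rw [← mul_assoc]; exact Nat.mul_le_mul_right _ hL
  have h2 : L * v ≤ g * (a * v) := by rw [← mul_assoc]; exact Nat.mul_le_mul_right _ hL
  have h3 : w ≤ g * w := Nat.le_mul_of_pos_left w hg
  have h4 : z ≤ g * z := Nat.le_mul_of_pos_left z hg
  nlinarith

theorem theorem8 (ℓ : ℕ) (hℓ : 2 ≤ ℓ) :
    -- the query algorithm, the word length factor and the constants in `Õ` depend on `ℓ` only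
    ∃ (P : Program) (c C e : ℕ),
      ∀ (n : ℕ) (G : SimpleGraph (Fin n)) (A : Fin n → ℝ),
        ∃ S : DataStructure,
          (∀ w ∈ S.words, w < 2 ^ (c * logSize n)) ∧
          S.space ≤ C * numPaths ℓ G * logSize n ^ e ∧
          ∀ x₁ x₂ : ℝ,
            ListsWithDelay (SimpleGraph.cycleGraph (2 * ℓ))
              (rangeOccurrences (SimpleGraph.cycleGraph (2 * ℓ)) G A x₁ x₂)
              (queryRun (c * logSize n) S P x₁ x₂)
              (C * logSize n ^ e) := by
  obtain ⟨r, rfl⟩ : ∃ r, ℓ = r + 1 := ⟨ℓ - 1, by omega⟩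
  set K := representativeBound r r with hK
  set a := r + 2 with ha
  set M := K * (r + 8) with hM
  -- With g = `logSize n` there are at most n^a < 2^(g * a) paths and at most g * a levels, so the
  -- table has fewer than 2^(2 * g * a + M) words; four spare bits cover 2 * N + 8. The single
  -- logarithmic factor, in space and in delay, is the number of levels.
  refine ⟨Program.query K r, 2 * a + M + 4, a * a ^ a * K * (r + 11) + Program.queryDelay K r a, 1,
    fun n G A => ?_⟩
  obtain ⟨D, hD, hN, hN', hstart, hpos, hvert, hlist⟩ := exists_cycle_layout (r := r) (by omega) G A
  set g := logSize n with hg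
  set b := (2 * a + M + 4) * g with hb
  have hg1 : 1 ≤ g := by simp [hg, logSize]
  have hng : n < 2 ^ g := Nat.lt_pow_succ_log_self (by decide) n
  have hNg : D.N < 2 ^ (g * a) := by
    refine hN.trans_lt ?_
    rw [pow_mul]
    exact Nat.pow_lt_pow_left hng (by omega)
  have hlev : D.levels ≤ g * a := Nat.size_le.2 hNg
  have hb1 : g * a + (g * a + M) + 4 ≤ b := by
    rw [hb]
    have : M ≤ M * g := Nat.le_mul_of_pos_right _ hg1
    nlinarith
  have hsmall : ∀ x, x ≤ g * a + (g * a + M) + 4 → 2 ^ x ≤ 2 ^ b := fun x hx =>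
    Nat.pow_le_pow_right (by decide) (hx.trans hb1)
  have hlevN : D.levels * D.N < 2 ^ (g * a + g * a) := by
    rw [pow_add]
    exact Nat.mul_lt_mul_of_lt_of_le (hlev.trans_lt Nat.lt_two_pow_self) hNg.le (by positivity)
  have hS : D.Stored K r b (D.dataStructure K r) := by
    refine hD.stored (lt_of_lt_of_le ?_ (hsmall (g * a + (g * a + M)) (by omega))) ?_
    · rw [Layout.size, mul_assoc, ← hM, ← add_assoc, pow_add]
      exact Nat.mul_lt_mul_of_lt_of_le hlevN Nat.lt_two_pow_self.le (by positivity)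
    · refine lt_of_lt_of_le ?_ (hsmall (g * a + 4) (by omega))
      rw [pow_add]; omega
  refine ⟨D.dataStructure K r, ?_, ?_, fun x₁ x₂ => ?_⟩
  · refine Layout.lt_of_mem_words ?_ (hlevN.trans_le (hsmall _ (by omega)))
      (hNg.trans_le (hsmall _ (by omega))) hD.Nout_le hstart hpos fun i t =>
        (hvert i t).trans_lt (hng.trans_le (hsmall _ ?_))
    · exact Nat.pow_lt_pow_right (by decide) (by omega)
    · have : g ≤ g * a := Nat.le_mul_of_pos_right _ (by omega)
      omega
  · rw [Layout.space_dataStructure, Layout.size, pow_one]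
    calc D.levels * D.N * K * (r + 11)
        ≤ (g * a) * (a ^ a * numPaths (r + 1) G) * K * (r + 11) := by gcongr
      _ = (a * a ^ a * K * (r + 11)) * numPaths (r + 1) G * g := by ring
      _ ≤ _ := by gcongr; omega
  · obtain ⟨Hs, h1, h2, h3⟩ := hlist x₁ x₂
    obtain ⟨⟨T, hT1, hT2⟩, hdelay⟩ := hS.query_spec hD x₁ x₂
    refine ⟨⟨T, Hs, _, hT1, hT2, h1, h2, h3⟩, fun t => ?_⟩
    have hle : Program.queryDelay K r D.levels ≤
        (a * a ^ a * K * (r + 11) + Program.queryDelay K r a) * g ^ 1 := by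
      rw [pow_one, add_mul]
      exact (Program.queryDelay_le K r hlev hg1).trans (Nat.le_add_left _ _)
    rcases hdelay t with h | h
    · exact .inl (h.of_le (Nat.add_le_add_left hle t))
    · exact .inr (h.trans_le (Nat.div_le_div_right
        (Config.length_out_iterate _ (Nat.add_le_add_left hle t))))
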